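/- **Model.** Unit-size orders $o_0,o_1,\dots$ arrive at random times $0<\tau_0<\tau_1<\cdots\to\infty$. The orders are i.i.d.; each is a bid or an ask with probability $1/2$, and its price has an absolutely continuous distribution on $\mathbb R$ with distribution function $F_b$ for bids and $F_a$ for asks (extended by $F(-\infty)=0$, $F(+\infty)=1$). Let $\Pi$ be a partition of $\mathbb R$ into finitely or infinitely many disjoint nonempty convex bins (points or intervals). In the (ordinary) limit order book with bins $\Pi$, which is empty at time $0$, let $\beta_t$ be the highest bid price at time $t$ ($-\infty$ if there is no bid) and $\alpha_t$ the lowest ask price ($+\infty$ if there is no ask). A bid arriving at price $p$ at time $t$ departs immediately together with the lowest ask if $p>\alpha_{t-}$ or if $p$ and $\alpha_{t-}$ lie in the same bin, and otherwise joins the book; an ask arriving at price $p$ departs immediately together with the highest bid if $p<\beta_{t-}$ or if $p$ and $\beta_{t-}$ lie in the same bin, and otherwise joins the book. (If all bins are single points, this is the unbinned book.) The thresholds are $$\kappa_b=\inf\{x:\ \text{almost surely } \beta_t<x \text{ for arbitrarily large } t\},\qquad \kappa_a=\sup\{x:\ \text{almost surely } \alpha_t>x \text{ for arbitrarily large } t\},$$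 elements of $[-\infty,\infty]$. **Statement.** Suppose that there are prices $x<y$ such that 1. $0<F_b(x)<F_b(y)<1$ and $0<F_a(x)<F_a(y)<1$; 2. $\Pi$ refines the partition $(-\infty,x]\cup(x,y]\cup(y,\infty)$, i.e. each of these three sets is a union of bins of $\Pi$; 3. $F_b(x)=1-F_a(y)$ and $F_b(y)=1-F_a(x)$. Put $X=F_b(x)$ and $Y=F_b(y)$. Then $$1-F_a(\kappa_a)=F_b(\kappa_b)\ \ge\ \frac{2X(1-X)-(1-Y)}{(1-X)+(Y-X)}.$$ In particular, if $Y=1-X$, then $F_b(\kappa_b)>0$ and $F_a(\kappa_a)<1$, and both $\kappa_b$ and $\kappa_a$ are finite. -/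

import Mathlib

open MeasureTheory ProbabilityTheory Filter

noncomputable section

/-- A limit order of unit size: `Sum.inl p` is a bid at price `p`,
`Sum.inr p` is an ask at price `p`. -/
abbrev LimitOrder : Type := ℝ ⊕ ℝ

/-- A partition of the price line into (finitely or infinitely many) disjoint nonempty
convex bins, i.e. points and intervals. -/
structure BinPartition where
  bins : Set (Set ℝ)
  isPartition : Setoid.IsPartition bins
  convex : ∀ s ∈ bins, s.OrdConnected

namespace BinPartition

/-- Two prices fall into the same bin. -/
def SameBin (P : BinPartition) (p q : ℝ) : Prop := ∃ s ∈ P.bins, p ∈ s ∧ q ∈ s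

/-- `P` refines `Q`: every bin of `Q` is a union of bins of `P`. -/
def Refines (P Q : BinPartition) : Prop :=
  ∀ D ∈ Q.bins, ∃ S : Set (Set ℝ), S ⊆ P.bins ∧ ⋃₀ S = D

/-- The partition `(-∞, x] ∪ (x, y] ∪ (y, ∞)`. -/
def three (x y : ℝ) (hxy : x < y) : BinPartition where
  bins := {Set.Iic x, Set.Ioc x y, Set.Ioi y}
  isPartition := by
    refine ⟨?_, fun a => ?_⟩
    · simp only [Set.mem_insert_iff, Set.mem_singleton_iff, not_or]
      exact ⟨Set.nonempty_Iic.ne_empty.symm, (Set.nonempty_Ioc.2 hxy).ne_empty.symm,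
        Set.nonempty_Ioi.ne_empty.symm⟩
    · rcases le_or_gt a x with h | h
      · refine ⟨Set.Iic x, ⟨by simp, h⟩, ?_⟩
        rintro s ⟨(rfl | rfl | rfl), hs⟩
        · rfl
        · exact absurd hs.1 (not_lt.2 h)
        · exact absurd (lt_trans hxy hs) (not_lt.2 h)
      · rcases le_or_gt a y with h' | h'
        · refine ⟨Set.Ioc x y, ⟨by simp, h, h'⟩, ?_⟩
          rintro s ⟨(rfl | rfl | rfl), hs⟩
          · exact absurd hs (not_le.2 h)
          · rfl
          · exact absurd hs (not_lt.2 h')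
        · refine ⟨Set.Ioi y, ⟨by simp, h'⟩, ?_⟩
          rintro s ⟨(rfl | rfl | rfl), hs⟩
          · exact absurd hs (not_le.2 h)
          · exact absurd hs.2 (not_le.2 h')
          · rfl
  convex := by
    rintro s (rfl | rfl | rfl)
    · exact Set.ordConnected_Iic
    · exact Set.ordConnected_Ioc
    · exact Set.ordConnected_Ioi

end BinPartition

/-- The state of a limit order book: the prices of the queued bids and of the queued asks,
counted with multiplicity. -/
structure Book where
  bids : Multiset ℝ
  asks : Multiset ℝ

namespace Book

/-- The empty book. -/
def empty : Book := ⟨0, 0⟩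

/-- The price of the highest bid, `-∞` if there are no bids. -/
def bestBid (L : Book) : EReal := (L.bids.map Real.toEReal).sup

/-- The price of the lowest ask, `+∞` if there are no asks. -/
def bestAsk (L : Book) : EReal := (L.asks.map Real.toEReal).inf

open Classical in
/-- The arrival of an order in the ordinary binned book with bins `P`.
An arriving bid at price `p` departs together with the lowest ask, at price `q` say, if `q < p`
or if `p` and `q` lie in the same bin; otherwise the bid joins the book.
Symmetrically for an arriving ask and the highest bid. -/
def submit (P : BinPartition) (L : Book) : LimitOrder → Book
  | Sum.inl p =>
      if ∃ q : ℝ, L.bestAsk = (q : EReal) ∧ (q < p ∨ P.SameBin p q) then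
        ⟨L.bids, L.asks.erase L.bestAsk.toReal⟩
      else ⟨p ::ₘ L.bids, L.asks⟩
  | Sum.inr p =>
      if ∃ q : ℝ, L.bestBid = (q : EReal) ∧ (p < q ∨ P.SameBin p q) then
        ⟨L.bids.erase L.bestBid.toReal, L.asks⟩
      else ⟨L.bids, p ::ₘ L.asks⟩

/-- The book after the first `n` orders of the sequence `o`, started empty. -/
def after (P : BinPartition) (o : ℕ → LimitOrder) : ℕ → Book
  | 0 => empty
  | n + 1 => (after P o n).submit P (o n)

/-- The book at time `t`, when the order `o n` arrives at time `τ n`. -/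
def atTime (P : BinPartition) (o : ℕ → LimitOrder) (τ : ℕ → ℝ) (t : ℝ) : Book :=
  after P o (Set.ncard {n : ℕ | τ n ≤ t})

end Book

/-- The law of an arriving order: a bid or an ask with probability `1/2` each, with price
distribution `νb` for bids and `νa` for asks. -/
def orderLaw (νb νa : Measure ℝ) : Measure LimitOrder :=
  (2⁻¹ : ENNReal) • νb.map Sum.inl + (2⁻¹ : ENNReal) • νa.map Sum.inr

/-- The arrival process: the orders `order 0, order 1, …` are i.i.d., each equally likely to be a
bid or an ask, with absolutely continuous price distributions `νb` and `νa`; the order `order n`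
arrives at the random time `time n`; almost surely no two orders arrive at the same time,
infinitely many orders arrive, and finitely many of them in any bounded time interval. -/
structure IsOrderFlow {Ω : Type*} [MeasurableSpace Ω] (μ : Measure Ω)
    (order : ℕ → Ω → LimitOrder) (time : ℕ → Ω → ℝ) (νb νa : Measure ℝ) : Prop where
  measurable_order : ∀ n, Measurable (order n)
  measurable_time : ∀ n, Measurable (time n)
  indep : iIndepFun order μ
  law : ∀ n, μ.map (order n) = orderLaw νb νa
  bid_ac : νb ≪ volume
  ask_ac : νa ≪ volume
  time_pos : ∀ᵐ ω ∂μ, 0 < time 0 ω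
  time_strictMono : ∀ᵐ ω ∂μ, StrictMono fun n => time n ω
  time_tendsto : ∀ᵐ ω ∂μ, Tendsto (fun n => time n ω) atTop atTop

section Thresholds

variable {Ω : Type*} [MeasurableSpace Ω]

/-- `β_t`, the price of the highest bid at time `t`. -/
def highestBid (P : BinPartition) (order : ℕ → Ω → LimitOrder) (time : ℕ → Ω → ℝ)
    (t : ℝ) (ω : Ω) : EReal :=
  (Book.atTime P (fun n => order n ω) (fun n => time n ω) t).bestBid

/-- `α_t`, the price of the lowest ask at time `t`. -/
def lowestAsk (P : BinPartition) (order : ℕ → Ω → LimitOrder) (time : ℕ → Ω → ℝ)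
    (t : ℝ) (ω : Ω) : EReal :=
  (Book.atTime P (fun n => order n ω) (fun n => time n ω) t).bestAsk

/-- The bid threshold `κ_b`: the infimum of the prices `x` such that almost surely `β_t < x`
happens infinitely often (at arbitrarily late times). -/
def bidThreshold (μ : Measure Ω) (P : BinPartition) (order : ℕ → Ω → LimitOrder)
    (time : ℕ → Ω → ℝ) : EReal :=
  sInf {x : EReal | ∀ᵐ ω ∂μ, ∃ᶠ t in atTop, highestBid P order time t ω < x}

/-- The ask threshold `κ_a`: the supremum of the prices `x` such that almost surely `α_t > x`
happens infinitely often (at arbitrarily late times). -/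
def askThreshold (μ : Measure Ω) (P : BinPartition) (order : ℕ → Ω → LimitOrder)
    (time : ℕ → Ω → ℝ) : EReal :=
  sSup {x : EReal | ∀ᵐ ω ∂μ, ∃ᶠ t in atTop, x < lowestAsk P order time t ω}

/-- `bidThreshold` is the phase transition point: a constant `κ` such that `β_t` is almost surely
infinitely often below every level above `κ`, and almost surely only finitely often below any
level under `κ`, is equal to it. -/
theorem eq_bidThreshold (μ : Measure Ω) [IsProbabilityMeasure μ] (P : BinPartition)
    (order : ℕ → Ω → LimitOrder) (time : ℕ → Ω → ℝ) (κ : EReal)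
    (h1 : ∀ x : EReal, κ < x → ∀ᵐ ω ∂μ, ∃ᶠ t in atTop, highestBid P order time t ω < x)
    (h2 : ∀ x : EReal, x < κ → ∀ᵐ ω ∂μ, ¬ ∃ᶠ t in atTop, highestBid P order time t ω < x) :
    κ = bidThreshold μ P order time := by
  apply le_antisymm
  · refine le_sInf fun x hx => not_lt.1 fun hlt => ?_
    obtain ⟨ω, h, h'⟩ := ((show ∀ᵐ _ ∂μ, _ from hx).and (h2 x hlt)).exists
    exact h' h
  · exact le_of_forall_gt_imp_ge_of_dense fun x hx => sInf_le (h1 x hx)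

/-- The same characterization for `askThreshold`. -/
theorem eq_askThreshold (μ : Measure Ω) [IsProbabilityMeasure μ] (P : BinPartition)
    (order : ℕ → Ω → LimitOrder) (time : ℕ → Ω → ℝ) (κ : EReal)
    (h1 : ∀ x : EReal, x < κ → ∀ᵐ ω ∂μ, ∃ᶠ t in atTop, x < lowestAsk P order time t ω)
    (h2 : ∀ x : EReal, κ < x → ∀ᵐ ω ∂μ, ¬ ∃ᶠ t in atTop, x < lowestAsk P order time t ω) :
    κ = askThreshold μ P order time := by
  apply le_antisymm
  · exact le_of_forall_lt_imp_le_of_dense fun x hx => le_sSup (h1 x hx)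
  · refine sSup_le fun x hx => not_lt.1 fun hlt => ?_
    obtain ⟨ω, h, h'⟩ := ((show ∀ᵐ _ ∂μ, _ from hx).and (h2 x hlt)).exists
    exact h' h

end Thresholds

/-- The cumulative distribution function of a price distribution, extended to `[-∞, ∞]`:
it is `0` at `-∞` and `1` at `+∞`. -/
def priceCDF (ν : Measure ℝ) (x : EReal) : ℝ := ν.real {p : ℝ | (p : EReal) ≤ x}

end

/-!
The book is studied through the linear growth rates of the numbers of bids and asks in it.

Orders depart in pairs and half of the arrivals are bids, so the book holds as many bids as asks up
to `o(n)` after `n` arrivals (`IsOrderFlow.ae_tendsto_card_sub_card`). If `z` is below the bid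
threshold, then with positive probability some bid at `z` or above is present from some time on;
on this event all later bids below `z` join the book and stay, so that the number of bids grows at
least at the rate `F_b(z) / 2` (`IsOrderFlow.frequently_le_card_bids`). If `z` is above the
threshold, then almost surely all bids in the book are infinitely often below `z`, and at these
times the number of bids is at most that of the arrivals below `z`
(`IsOrderFlow.ae_frequently_card_bids_le`). The same holds for asks, by reflection of the price
axis. Comparing the two sides at a single sample point for which the law of large numbers holds
gives `1 - F_a(κ_a) = F_b(κ_b)`; no zero-one law is needed, since a positive probability suffices
on one side of each comparison.

The lower bound comes from a linear potential. Divide the prices into the classes `(-∞, x]`,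
`(x, y]`, `(y, ∞)` and give bids in these classes the weights `1`, `θ`, `-1` and asks the weights
`-1`, `θ`, `1`, where `θ = (1 - Y) / ((1 - X) + (Y - X))`. For this `θ` the sum of the weights of
the orders in the book has, in every state of the book, a mean increment per arrival of at least
`v = X - θ (1 - X)`, which is the claimed bound (`Book.exists_le_potential_submit_inl`). The only
information needed about the bins is that orders in the same bin are in the same class. Exponential
moments and the Borel–Cantelli lemma turn the drift into the almost sure growth rate `v`
(`Book.ae_eventually_le_potential`), and the potential is at most the number of orders in the book,
which at suitable times is at most `n F_b(z) + o(n)` for `z` above `κ_b`.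

Finiteness of the thresholds needs in addition that `F_b(κ_b) < 1`: bids above `y` and asks up to
`x` are never in the book together, so at any time either all bids are at most `y` or all asks are
above `x`, and both kinds arrive at the rate `Y / 2`
(`IsOrderFlow.measure_Iio_le_of_lt_bidThreshold`).
-/

/-! ### Bins -/

namespace BinPartition

lemma sameBin_refl (P : BinPartition) (p : ℝ) : P.SameBin p p := by
  obtain ⟨s, ⟨hs, hp⟩, -⟩ := P.isPartition.2 p
  exact ⟨s, hs, hp, hp⟩

lemma SameBin.symm {P : BinPartition} {p q : ℝ} (h : P.SameBin p q) : P.SameBin q p := by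
  obtain ⟨s, hs, hp, hq⟩ := h
  exact ⟨s, hs, hq, hp⟩

lemma SameBin.of_mem_Icc {P : BinPartition} {p q a b : ℝ} (h : P.SameBin p q)
    (ha : a ∈ Set.Icc p q) (hb : b ∈ Set.Icc p q) : P.SameBin a b := by
  obtain ⟨s, hs, hp, hq⟩ := h
  exact ⟨s, hs, (P.convex s hs).out hp hq ha, (P.convex s hs).out hp hq hb⟩

lemma Refines.sameBin {P Q : BinPartition} (h : P.Refines Q) {p q : ℝ} (hpq : P.SameBin p q) :
    Q.SameBin p q := by
  obtain ⟨s, hs, hp, hq⟩ := hpq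
  obtain ⟨D, ⟨hD, hpD⟩, -⟩ := Q.isPartition.2 p
  obtain ⟨S, hS, rfl⟩ := h D hD
  obtain ⟨s', hs', hps'⟩ := hpD
  have : s' = s := (P.isPartition.2 p).unique ⟨hS hs', hps'⟩ ⟨hs, hp⟩
  subst this
  exact ⟨_, hD, ⟨s', hs', hp⟩, ⟨s', hs', hq⟩⟩

/-- The reflection of a partition at the origin. -/
def reflect (P : BinPartition) : BinPartition where
  bins := {s | Neg.neg ⁻¹' s ∈ P.bins}
  isPartition := by
    refine ⟨fun h => P.isPartition.1 (by simpa using h), fun a => ?_⟩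
    obtain ⟨s, ⟨hs, ha⟩, huniq⟩ := P.isPartition.2 (-a)
    refine ⟨Neg.neg ⁻¹' s, ⟨by simpa using hs, ha⟩, ?_⟩
    rintro t ⟨ht, hat⟩
    rw [← huniq (Neg.neg ⁻¹' t) ⟨ht, by simpa using hat⟩]
    simp
  convex := fun s hs => by
    have := (P.convex _ hs).preimage_anti (f := Neg.neg) fun a b hab => neg_le_neg hab
    simpa [Set.preimage_preimage] using this

lemma reflect_sameBin {P : BinPartition} {p q : ℝ} :
    P.reflect.SameBin p q ↔ P.SameBin (-p) (-q) := by
  constructor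
  · rintro ⟨s, hs, hp, hq⟩
    exact ⟨Neg.neg ⁻¹' s, hs, by simpa using hp, by simpa using hq⟩
  · rintro ⟨s, hs, hp, hq⟩
    exact ⟨Neg.neg ⁻¹' s, by simpa [reflect] using hs, hp, hq⟩

end BinPartition

/-! ### The dynamics of the book, and its reflection symmetry -/

namespace LimitOrder

/-- Reflection of the price axis turns a bid at `p` into an ask at `-p` and vice versa. -/
def reflect : LimitOrder → LimitOrder := Sum.elim (fun p => Sum.inr (-p)) (fun p => Sum.inl (-p))

@[simp] lemma reflect_inl (p : ℝ) : reflect (Sum.inl p) = Sum.inr (-p) := rfl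

@[simp] lemma reflect_inr (p : ℝ) : reflect (Sum.inr p) = Sum.inl (-p) := rfl

end LimitOrder

namespace Book

/-- Reflection of the price axis exchanges the bids and the asks in the book. -/
def reflect (L : Book) : Book := ⟨L.asks.map Neg.neg, L.bids.map Neg.neg⟩

@[simp] lemma reflect_reflect (L : Book) : L.reflect.reflect = L := by
  cases L; simp [reflect]

lemma bestBid_reflect (L : Book) : L.reflect.bestBid = -L.bestAsk := by
  unfold reflect bestBid bestAsk
  induction L.asks using Multiset.induction with
  | empty => simp
  | cons a s ih =>
    simp only [Multiset.map_cons, Multiset.sup_cons, Multiset.inf_cons, ih]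
    rw [EReal.neg_strictAnti.antitone.map_inf]
    simp

lemma bestAsk_reflect (L : Book) : L.reflect.bestAsk = -L.bestBid := by
  rw [← neg_neg L.reflect.bestAsk, ← bestBid_reflect, reflect_reflect]

lemma submit_reflect (P : BinPartition) (L : Book) (o : LimitOrder) :
    (L.submit P o).reflect = L.reflect.submit P.reflect (LimitOrder.reflect o) := by
  have hneg : Function.Injective (Neg.neg : ℝ → ℝ) := neg_injective
  rcases o with p | p
  · have hiff : (∃ q : ℝ, L.bestAsk = q ∧ (q < p ∨ P.SameBin p q)) ↔
        ∃ q : ℝ, L.reflect.bestBid = q ∧ (-p < q ∨ P.reflect.SameBin (-p) q) := by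
      constructor
      · rintro ⟨q, hq, h⟩
        exact ⟨-q, by rw [bestBid_reflect, hq]; simp, by
          simpa [BinPartition.reflect_sameBin] using h⟩
      · rintro ⟨q, hq, h⟩
        refine ⟨-q, ?_, ?_⟩
        · rw [← neg_neg L.bestAsk, ← bestBid_reflect, hq]; simp
        · simp only [BinPartition.reflect_sameBin, neg_neg] at h
          exact h.imp_left fun h => by linarith
    by_cases h : ∃ q : ℝ, L.bestAsk = q ∧ (q < p ∨ P.SameBin p q)
    · rw [LimitOrder.reflect_inl, submit, submit, if_pos h, if_pos (hiff.1 h), bestBid_reflect,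
        EReal.toReal_neg_eq]
      simp only [reflect, Multiset.map_erase _ hneg]
    · rw [LimitOrder.reflect_inl, submit, submit, if_neg h, if_neg (mt hiff.2 h)]
      simp [reflect]
  · have hiff : (∃ q : ℝ, L.bestBid = q ∧ (p < q ∨ P.SameBin p q)) ↔
        ∃ q : ℝ, L.reflect.bestAsk = q ∧ (q < -p ∨ P.reflect.SameBin (-p) q) := by
      constructor
      · rintro ⟨q, hq, h⟩
        exact ⟨-q, by rw [bestAsk_reflect, hq]; simp, by
          simpa [BinPartition.reflect_sameBin] using h⟩
      · rintro ⟨q, hq, h⟩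
        refine ⟨-q, ?_, ?_⟩
        · rw [← neg_neg L.bestBid, ← bestAsk_reflect, hq]; simp
        · simp only [BinPartition.reflect_sameBin, neg_neg] at h
          exact h.imp_left fun h => by linarith
    by_cases h : ∃ q : ℝ, L.bestBid = q ∧ (p < q ∨ P.SameBin p q)
    · rw [LimitOrder.reflect_inr, submit, submit, if_pos h, if_pos (hiff.1 h), bestAsk_reflect,
        EReal.toReal_neg_eq]
      simp only [reflect, Multiset.map_erase _ hneg]
    · rw [LimitOrder.reflect_inr, submit, submit, if_neg h, if_neg (mt hiff.2 h)]
      simp [reflect]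

lemma after_reflect (P : BinPartition) (o : ℕ → LimitOrder) (n : ℕ) :
    (after P o n).reflect = after P.reflect (fun k => LimitOrder.reflect (o k)) n := by
  induction n with
  | zero => simp [after, empty, reflect]
  | succ n ih => rw [after, submit_reflect, ih, after]

lemma bestAsk_le {L : Book} {a : ℝ} (ha : a ∈ L.asks) : L.bestAsk ≤ a :=
  Multiset.inf_le (Multiset.mem_map_of_mem _ ha)

lemma asks_eq_zero_or_exists_bestAsk (L : Book) :
    L.asks = 0 ∨ ∃ q ∈ L.asks, L.bestAsk = (q : EReal) ∧ ∀ a ∈ L.asks, q ≤ a := by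
  refine or_iff_not_imp_left.2 fun h => ?_
  obtain ⟨q, hq, hmin⟩ := L.asks.toFinset.exists_min_image id (by
    obtain ⟨a, ha⟩ := Multiset.exists_mem_of_ne_zero h
    exact ⟨a, by simpa using ha⟩)
  simp only [Multiset.mem_toFinset, id] at hq hmin
  refine ⟨q, hq, le_antisymm (bestAsk_le hq) (Multiset.le_inf.2 fun b hb => ?_), hmin⟩
  obtain ⟨a, ha, rfl⟩ := Multiset.mem_map.1 hb
  exact EReal.coe_le_coe_iff.2 (hmin a ha)

lemma le_bestBid {L : Book} {b : ℝ} (hb : b ∈ L.bids) : (b : EReal) ≤ L.bestBid :=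
  Multiset.le_sup (Multiset.mem_map_of_mem _ hb)

lemma exists_mem_bids_of_le_bestBid {L : Book} {z : ℝ} (h : (z : EReal) ≤ L.bestBid) :
    ∃ b ∈ L.bids, z ≤ b := by
  have hba : L.reflect.bestAsk = -L.bestBid := bestAsk_reflect L
  rcases L.reflect.asks_eq_zero_or_exists_bestAsk with h0 | ⟨q, hq, hbest, -⟩
  · have : L.bids = 0 := by simpa [reflect] using h0
    simp [bestBid, this] at h
  · obtain ⟨b, hb, rfl⟩ := Multiset.mem_map.1 hq
    refine ⟨b, hb, ?_⟩
    rw [hbest, EReal.coe_neg, neg_inj] at hba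
    rwa [← hba, EReal.coe_le_coe_iff] at h

/-- An arriving bid either removes the lowest ask, or it joins the book and then lies in a
strictly lower bin than every ask. -/
lemma submit_inl_cases (P : BinPartition) (L : Book) (p : ℝ) :
    (∃ q s, L.asks = q ::ₘ s ∧ (∀ a ∈ L.asks, q ≤ a) ∧ L.bestAsk = (q : EReal) ∧
      (q < p ∨ P.SameBin p q) ∧ L.submit P (Sum.inl p) = ⟨L.bids, s⟩) ∨
    ((∀ a ∈ L.asks, p < a ∧ ¬ P.SameBin p a) ∧
      L.submit P (Sum.inl p) = ⟨p ::ₘ L.bids, L.asks⟩) := by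
  by_cases h : ∃ q : ℝ, L.bestAsk = (q : EReal) ∧ (q < p ∨ P.SameBin p q)
  · left
    have hs : L.submit P (Sum.inl p) = _ := if_pos h
    obtain ⟨q, hq, hm⟩ := h
    rcases L.asks_eq_zero_or_exists_bestAsk with h0 | ⟨q', hq', hqq', hmin⟩
    · simp [bestAsk, h0] at hq
    · obtain rfl : q = q' := by rw [hq] at hqq'; exact_mod_cast hqq'
      refine ⟨q, _, (Multiset.cons_erase hq').symm, hmin, hq, hm, hs.trans ?_⟩
      rw [hq, EReal.toReal_coe]
  · right
    refine ⟨fun a ha => ?_, if_neg h⟩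
    rcases L.asks_eq_zero_or_exists_bestAsk with h0 | ⟨q, hq', hq, hmin⟩
    · simp [h0] at ha
    · have hn : ¬ (q < p ∨ P.SameBin p q) := fun hm => h ⟨q, hq, hm⟩
      rw [not_or, not_lt] at hn
      have hpq : p < q := lt_of_le_of_ne hn.1 fun e => hn.2 (e ▸ P.sameBin_refl p)
      have hqa := hmin a ha
      exact ⟨hpq.trans_le hqa, fun hs => hn.2 (hs.of_mem_Icc ⟨le_rfl, hpq.le.trans hqa⟩
        ⟨hpq.le, hqa⟩)⟩

/-- An arriving ask either removes the highest bid, or it joins the book and then lies in a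
strictly higher bin than every bid. -/
lemma submit_inr_cases (P : BinPartition) (L : Book) (p : ℝ) :
    (∃ q s, L.bids = q ::ₘ s ∧ (∀ b ∈ L.bids, b ≤ q) ∧ L.bestBid = (q : EReal) ∧
      (p < q ∨ P.SameBin p q) ∧ L.submit P (Sum.inr p) = ⟨s, L.asks⟩) ∨
    ((∀ b ∈ L.bids, b < p ∧ ¬ P.SameBin p b) ∧
      L.submit P (Sum.inr p) = ⟨L.bids, p ::ₘ L.asks⟩) := by
  have hr : L.submit P (Sum.inr p) =
      (L.reflect.submit P.reflect (Sum.inl (-p))).reflect := by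
    rw [← LimitOrder.reflect_inr, ← submit_reflect, reflect_reflect]
  have hb : L.bids = L.reflect.asks.map Neg.neg := by simp [reflect]
  rcases submit_inl_cases P.reflect L.reflect (-p) with
    ⟨q, s, hq, hmin, hbest, hm, hs⟩ | ⟨hmin, hs⟩
  · left
    refine ⟨-q, s.map Neg.neg, by rw [hb, hq, Multiset.map_cons], fun b hbb => ?_, ?_, ?_, ?_⟩
    · have := hmin (-b) (Multiset.mem_map_of_mem _ hbb)
      linarith
    · rw [bestAsk_reflect] at hbest
      rw [← neg_neg L.bestBid, hbest, EReal.coe_neg]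
    · rw [BinPartition.reflect_sameBin, neg_neg] at hm
      exact hm.imp_left fun h => by linarith
    · rw [hr, hs]; simp [reflect]
  · right
    refine ⟨fun b hbb => ?_, ?_⟩
    · have := hmin (-b) (Multiset.mem_map_of_mem _ hbb)
      rw [BinPartition.reflect_sameBin, neg_neg, neg_neg] at this
      exact ⟨by linarith [this.1], this.2⟩
    · rw [hr, hs]; simp [reflect]

/-- Every bid lies in a strictly lower bin than every ask. -/
def Separated (P : BinPartition) (L : Book) : Prop :=
  ∀ b ∈ L.bids, ∀ a ∈ L.asks, b < a ∧ ¬ P.SameBin b a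

lemma Separated.submit {P : BinPartition} {L : Book} (h : L.Separated P) (o : LimitOrder) :
    (L.submit P o).Separated P := by
  rcases o with p | p
  · rcases submit_inl_cases P L p with ⟨q, s, hq, -, -, -, hs⟩ | ⟨hmin, hs⟩ <;> rw [hs]
    · exact fun b hb a ha => h b hb a (by rw [hq]; exact Multiset.mem_cons_of_mem ha)
    · intro b hb a ha
      rcases Multiset.mem_cons.1 hb with rfl | hb
      exacts [hmin a ha, h b hb a ha]
  · rcases submit_inr_cases P L p with ⟨q, s, hq, -, -, -, hs⟩ | ⟨hmin, hs⟩ <;> rw [hs]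
    · exact fun b hb a ha => h b (by rw [hq]; exact Multiset.mem_cons_of_mem hb) a ha
    · intro b hb a ha
      rcases Multiset.mem_cons.1 ha with rfl | ha
      exacts [(hmin b hb).imp_right fun h hs => h hs.symm, h b hb a ha]

lemma separated_after (P : BinPartition) (o : ℕ → LimitOrder) (n : ℕ) :
    (after P o n).Separated P := by
  induction n with
  | zero => intro b hb; simp [after, empty] at hb
  | succ n ih => exact ih.submit _

/-! ### Counting orders -/

/-- Bids minus asks in the book equals bids minus asks among the arrivals, since orders depart
in pairs. -/
lemma card_bids_sub_card_asks (P : BinPartition) (o : ℕ → LimitOrder) (n : ℕ) :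
    ((after P o n).bids.card : ℝ) - (after P o n).asks.card =
      ∑ k ∈ Finset.range n, Sum.elim (fun _ => (1 : ℝ)) (fun _ => -1) (o k) := by
  induction n with
  | zero => simp [after, empty]
  | succ n ih =>
    rw [Finset.sum_range_succ, ← ih, after]
    rcases o n with p | p
    · rcases submit_inl_cases P (after P o n) p with ⟨q, s, hq, -, -, -, hs⟩ | ⟨-, hs⟩ <;>
        rw [hs]
      · simp [hq]; ring
      · simp; ring
    · rcases submit_inr_cases P (after P o n) p with ⟨q, s, hq, -, -, -, hs⟩ | ⟨-, hs⟩ <;>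
        rw [hs]
      · simp [hq]; ring
      · simp; ring

lemma sum_bids_le (P : BinPartition) (o : ℕ → LimitOrder) {f : ℝ → ℝ} (hf : 0 ≤ f) (n : ℕ) :
    ((after P o n).bids.map f).sum ≤ ∑ k ∈ Finset.range n, Sum.elim f 0 (o k) := by
  induction n with
  | zero => simp [after, empty]
  | succ n ih =>
    rw [Finset.sum_range_succ, after]
    rcases o n with p | p
    · have := hf p
      rcases submit_inl_cases P (after P o n) p with ⟨q, s, hq, -, -, -, hs⟩ | ⟨-, hs⟩ <;>
        rw [hs]
      · simp at this ⊢; linarith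
      · simp at this ⊢; linarith
    · rcases submit_inr_cases P (after P o n) p with ⟨q, s, hq, -, -, -, hs⟩ | ⟨-, hs⟩ <;>
        rw [hs]
      · have := hf q
        simp [hq] at ih this ⊢; linarith
      · simpa using ih

lemma card_bids_le_of_forall_mem (P : BinPartition) (o : ℕ → LimitOrder) {S : Set ℝ} {n : ℕ}
    (h : ∀ b ∈ (after P o n).bids, b ∈ S) :
    ((after P o n).bids.card : ℝ) ≤
      ∑ k ∈ Finset.range n, Sum.elim (S.indicator 1) 0 (o k) := by
  refine le_trans (le_of_eq ?_)
    (sum_bids_le P o (f := S.indicator 1) (Set.indicator_nonneg fun _ _ => zero_le_one) n)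
  rw [Multiset.map_congr rfl (g := fun _ => (1 : ℝ)) fun b hb => by simp [h b hb]]
  simp

/-- As long as some bid is at `z` or above, the bids below `z` are never served. Here this is
assumed from the `N`-th order on. -/
lemma le_card_bids_of_le_bestBid (P : BinPartition) (o : ℕ → LimitOrder) {z : ℝ} {N : ℕ}
    (h : ∀ n ≥ N, (z : EReal) ≤ (after P o n).bestBid) (n : ℕ) :
    ∑ k ∈ Finset.range n, Sum.elim ((Set.Iio z).indicator 1) 0 (o k) - N ≤
      ((after P o n).bids.card : ℝ) := by
  set f : ℝ → ℝ := (Set.Iio z).indicator 1 with hf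
  have hf1 : ∀ p, f p ≤ 1 := fun p => Set.indicator_le_self' (fun _ _ => zero_le_one) p
  have hf0 : ∀ p, 0 ≤ f p := fun p => Set.indicator_nonneg (fun _ _ => zero_le_one) p
  have hsum : ∀ s : Multiset ℝ, 0 ≤ (s.map f).sum := fun s =>
    Multiset.sum_nonneg fun r hr => by
      obtain ⟨p, -, rfl⟩ := Multiset.mem_map.1 hr; exact hf0 p
  have key : ∑ k ∈ Finset.range n, Sum.elim f 0 (o k) - N ≤
      ((after P o n).bids.map f).sum := by
    rcases le_total n N with hn | hn
    · have : ∑ k ∈ Finset.range n, Sum.elim f 0 (o k) ≤ ∑ k ∈ Finset.range n, (1 : ℝ) :=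
        Finset.sum_le_sum fun k _ => by rcases o k with p | p <;> simp [hf1]
      have hnN : (n : ℝ) ≤ N := by exact_mod_cast hn
      simp only [Finset.sum_const, Finset.card_range, nsmul_eq_mul, mul_one] at this
      linarith [hsum (after P o n).bids]
    · induction n, hn using Nat.le_induction with
      | base =>
        have : ∑ k ∈ Finset.range N, Sum.elim f 0 (o k) ≤ ∑ k ∈ Finset.range N, (1 : ℝ) :=
          Finset.sum_le_sum fun k _ => by rcases o k with p | p <;> simp [hf1]
        simp only [Finset.sum_const, Finset.card_range, nsmul_eq_mul, mul_one] at this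
        linarith [hsum (after P o N).bids]
      | succ n hn ih =>
        rw [Finset.sum_range_succ, after]
        rcases o n with p | p
        · rcases submit_inl_cases P (after P o n) p with
            ⟨q, s, hq, -, -, hm, hs⟩ | ⟨-, hs⟩ <;> rw [hs]
          · -- a served bid lies at `z` or above, because the highest bid is already there
            have hfp : f p = 0 := by
              refine Set.indicator_of_notMem (fun hp => ?_) _
              have hzb := h n hn
              obtain ⟨b, hb, hbz⟩ := exists_mem_bids_of_le_bestBid hzb
              obtain ⟨h1, h2⟩ := separated_after P o n b hb q (by simp [hq])
              have hpz : p < z := hp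
              rcases hm with hm | hm
              · linarith
              · exact h2 (hm.of_mem_Icc ⟨by linarith, h1.le⟩ ⟨by linarith, le_rfl⟩)
            simp only [Sum.elim_inl, hfp]; linarith
          · simp only [Sum.elim_inl, Multiset.map_cons, Multiset.sum_cons]; linarith
        · rcases submit_inr_cases P (after P o n) p with
            ⟨q, s, hq, -, hb, -, hs⟩ | ⟨-, hs⟩ <;> rw [hs]
          · have hfq : f q = 0 := by
              refine Set.indicator_of_notMem (fun hp => ?_) _
              have := h n hn
              rw [hb, EReal.coe_le_coe_iff] at this
              exact absurd hp (not_lt.2 this)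
            rw [hq, Multiset.map_cons, Multiset.sum_cons, hfq] at ih
            simp only [Sum.elim_inr, Pi.zero_apply]; linarith
          · simpa using ih
  refine key.trans ?_
  have := Multiset.sum_map_le_sum_map (s := (after P o n).bids) f (fun _ => (1 : ℝ))
    fun p _ => hf1 p
  simpa using this

lemma card_asks_le_of_forall_mem (P : BinPartition) (o : ℕ → LimitOrder) {S : Set ℝ} {n : ℕ}
    (h : ∀ a ∈ (after P o n).asks, a ∈ S) :
    ((after P o n).asks.card : ℝ) ≤
      ∑ k ∈ Finset.range n, Sum.elim 0 (S.indicator 1) (o k) := by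
  have := card_bids_le_of_forall_mem P.reflect (fun k => LimitOrder.reflect (o k))
    (S := {p | -p ∈ S}) (n := n) (by
      rw [← after_reflect]
      intro b hb
      obtain ⟨a, ha, rfl⟩ := Multiset.mem_map.1 hb
      simpa using h a ha)
  rw [← after_reflect] at this
  refine le_trans (by simp [reflect]) (this.trans (Finset.sum_le_sum fun k _ => ?_))
  rcases o k with p | p
  · simp
  · by_cases hp : p ∈ S <;> simp [hp]

lemma le_card_asks_of_bestAsk_le (P : BinPartition) (o : ℕ → LimitOrder) {z : ℝ} {N : ℕ}
    (h : ∀ n ≥ N, (after P o n).bestAsk ≤ (z : EReal)) (n : ℕ) :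
    ∑ k ∈ Finset.range n, Sum.elim 0 ((Set.Ioi z).indicator 1) (o k) - N ≤
      ((after P o n).asks.card : ℝ) := by
  have := le_card_bids_of_le_bestBid P.reflect (fun k => LimitOrder.reflect (o k)) (z := -z)
    (N := N) (fun n hn => by
      rw [← after_reflect, bestBid_reflect, EReal.coe_neg]
      exact EReal.neg_le_neg_iff.2 (h n hn)) n
  rw [← after_reflect] at this
  refine le_trans (sub_le_sub_right (Finset.sum_le_sum fun k _ => ?_) _)
    (this.trans (by simp [reflect]))
  rcases o k with p | p <;> simp [Set.indicator]

end Book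

/-! ### Measurability of the book -/

/-- The σ-algebra on books generated by the sums of measurable functions over the bids and over
the asks. -/
instance Book.instMeasurableSpace : MeasurableSpace Book :=
  MeasurableSpace.comap (fun L (f : {f : ℝ → ℝ // Measurable f}) =>
    ((L.bids.map f.1).sum, (L.asks.map f.1).sum)) inferInstance

namespace Book

lemma measurable_sum_bids {f : ℝ → ℝ} (hf : Measurable f) :
    Measurable fun L : Book => (L.bids.map f).sum := by
  have h : Measurable fun (L : Book) (f : {f : ℝ → ℝ // Measurable f}) =>
    ((L.bids.map f.1).sum, (L.asks.map f.1).sum) := comap_measurable _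
  exact (measurable_pi_iff.1 h ⟨f, hf⟩).fst

lemma measurable_sum_asks {f : ℝ → ℝ} (hf : Measurable f) :
    Measurable fun L : Book => (L.asks.map f).sum := by
  have h : Measurable fun (L : Book) (f : {f : ℝ → ℝ // Measurable f}) =>
    ((L.bids.map f.1).sum, (L.asks.map f.1).sum) := comap_measurable _
  exact (measurable_pi_iff.1 h ⟨f, hf⟩).snd

lemma measurable_of_sum {α : Type*} [MeasurableSpace α] {F : α → Book}
    (hb : ∀ f : ℝ → ℝ, Measurable f → Measurable fun x => ((F x).bids.map f).sum)
    (ha : ∀ f : ℝ → ℝ, Measurable f → Measurable fun x => ((F x).asks.map f).sum) :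
    Measurable F :=
  measurable_comap_iff.2 <| measurable_pi_iff.2 fun f => (hb f.1 f.2).prodMk (ha f.1 f.2)

lemma measurable_reflect : Measurable reflect :=
  measurable_of_sum
    (fun f hf => by
      simpa [reflect, Function.comp_def] using measurable_sum_asks (hf.comp measurable_neg))
    (fun f hf => by
      simpa [reflect, Function.comp_def] using measurable_sum_bids (hf.comp measurable_neg))

lemma measurable_bestAsk : Measurable bestAsk := by
  refine measurable_of_Iio fun c => ?_
  have hS : MeasurableSet {p : ℝ | (p : EReal) < c} :=
    measurable_coe_real_ereal measurableSet_Iio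
  have : bestAsk ⁻¹' Set.Iio c =
      {L | 0 < (L.asks.map ({p : ℝ | (p : EReal) < c}.indicator (1 : ℝ → ℝ))).sum} := by
    ext L
    have hnn : ∀ a, 0 ≤ {p : ℝ | (p : EReal) < c}.indicator (1 : ℝ → ℝ) a := fun a =>
      Set.indicator_nonneg (fun _ _ => zero_le_one) a
    rcases L.asks_eq_zero_or_exists_bestAsk with h0 | ⟨q, hq, hbest, hmin⟩
    · simp [bestAsk, h0]
    · obtain ⟨s, hs⟩ := Multiset.exists_cons_of_mem hq
      simp only [Set.mem_preimage, Set.mem_Iio, hbest, Set.mem_ofPred_eq]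
      constructor
      · intro h
        rw [hs, Multiset.map_cons, Multiset.sum_cons,
          Set.indicator_of_mem (by exact h : q ∈ {p : ℝ | (p : EReal) < c})]
        have : 0 ≤ (s.map ({p : ℝ | (p : EReal) < c}.indicator (1 : ℝ → ℝ))).sum :=
          Multiset.sum_nonneg fun r hr => by
            obtain ⟨p, -, rfl⟩ := Multiset.mem_map.1 hr; exact hnn p
        simp only [Pi.one_apply]; linarith
      · intro h
        by_contra hc
        refine h.ne' (Multiset.sum_eq_zero fun r hr => ?_)
        obtain ⟨a, ha, rfl⟩ := Multiset.mem_map.1 hr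
        exact Set.indicator_of_notMem (s := {p : ℝ | (p : EReal) < c}) (fun hac => hc
          ((EReal.coe_le_coe_iff.2 (hmin a ha)).trans_lt hac)) (1 : ℝ → ℝ)
  rw [this]
  exact measurableSet_lt measurable_const
    (measurable_sum_asks (measurable_one.indicator hS))

end Book

/-- Distinct prices in the same bin are separated by a rational in that bin, and bins are
intervals, so `SameBin` is a countable union of measurable rectangles and the diagonal. -/
lemma BinPartition.measurableSet_sameBin (P : BinPartition) :
    MeasurableSet {x : ℝ × ℝ | P.SameBin x.1 x.2} := by
  have hbin : ∀ r : ℝ, MeasurableSet {p | P.SameBin p r} := fun r => by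
    obtain ⟨s, ⟨hs, hr⟩, huniq⟩ := P.isPartition.2 r
    have : {p | P.SameBin p r} = s := by
      ext p
      constructor
      · rintro ⟨t, ht, hp, hrt⟩
        rwa [huniq t ⟨ht, hrt⟩] at hp
      · exact fun hp => ⟨s, hs, hp, hr⟩
    rw [this]
    exact (P.convex s hs).measurableSet
  have : {x : ℝ × ℝ | P.SameBin x.1 x.2} =
      {x | x.1 = x.2} ∪ ⋃ r : ℚ, {p | P.SameBin p r} ×ˢ {p | P.SameBin p r} := by
    ext ⟨p, q⟩
    simp only [Set.mem_ofPred_eq, Set.mem_union, Set.mem_iUnion, Set.mem_prod]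
    constructor
    · intro h
      rcases lt_trichotomy p q with hpq | hpq | hpq
      · obtain ⟨r, hr1, hr2⟩ := exists_rat_btwn hpq
        exact .inr ⟨r, h.of_mem_Icc ⟨le_rfl, hpq.le⟩ ⟨hr1.le, hr2.le⟩,
          h.of_mem_Icc ⟨hpq.le, le_rfl⟩ ⟨hr1.le, hr2.le⟩⟩
      · exact .inl hpq
      · obtain ⟨r, hr1, hr2⟩ := exists_rat_btwn hpq
        exact .inr ⟨r, h.symm.of_mem_Icc ⟨hpq.le, le_rfl⟩ ⟨hr1.le, hr2.le⟩,
          h.symm.of_mem_Icc ⟨le_rfl, hpq.le⟩ ⟨hr1.le, hr2.le⟩⟩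
    · rintro (rfl | ⟨r, ⟨s, hs, hps, hrs⟩, ⟨t, ht, hqt, hrt⟩⟩)
      · exact P.sameBin_refl p
      · obtain rfl : s = t := (P.isPartition.2 r).unique ⟨hs, hrs⟩ ⟨ht, hrt⟩
        exact ⟨s, hs, hps, hqt⟩
  rw [this]
  exact (measurableSet_eq_fun measurable_fst measurable_snd).union
    (.iUnion fun r => (hbin r).prod (hbin r))

namespace Book

lemma measurable_submit_inl (P : BinPartition) :
    Measurable fun x : Book × ℝ => x.1.submit P (Sum.inl x.2) := by
  classical
  let M : Set (Book × ℝ) :=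
    {x | ∃ q : ℝ, x.1.bestAsk = (q : EReal) ∧ (q < x.2 ∨ P.SameBin x.2 q)}
  have hα : Measurable fun x : Book × ℝ => x.1.bestAsk := measurable_bestAsk.comp measurable_fst
  have hq : Measurable fun x : Book × ℝ => x.1.bestAsk.toReal := hα.ereal_toReal
  have hM : MeasurableSet M := by
    have : M = {x | x.1.bestAsk ≠ ⊤} ∩ {x | x.1.bestAsk ≠ ⊥} ∩
        ({x | x.1.bestAsk.toReal < x.2} ∪
          (fun x : Book × ℝ => (x.2, x.1.bestAsk.toReal)) ⁻¹' {x | P.SameBin x.1 x.2}) := by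
      ext x
      constructor
      · rintro ⟨q, hq, h⟩
        simpa [hq] using h
      · rintro ⟨⟨h1, h2⟩, h⟩
        exact ⟨x.1.bestAsk.toReal, (EReal.coe_toReal h1 h2).symm, h⟩
    rw [this]
    exact (((hα (measurableSet_singleton ⊤)).compl).inter
      ((hα (measurableSet_singleton ⊥)).compl)).inter ((measurableSet_lt hq measurable_snd).union
        ((measurable_snd.prodMk hq) P.measurableSet_sameBin))
  have hcases : ∀ x : Book × ℝ,
      (x ∈ M → ∃ s, x.1.asks = x.1.bestAsk.toReal ::ₘ s ∧
        x.1.submit P (Sum.inl x.2) = ⟨x.1.bids, s⟩) ∧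
      (x ∉ M → x.1.submit P (Sum.inl x.2) = ⟨x.2 ::ₘ x.1.bids, x.1.asks⟩) := by
    intro x
    refine ⟨fun hx => ?_, fun hx => if_neg hx⟩
    rcases submit_inl_cases P x.1 x.2 with ⟨q, s, hq, -, hb, -, hs⟩ | ⟨hmin, -⟩
    · exact ⟨s, by rw [hb, EReal.toReal_coe, hq], hs⟩
    · obtain ⟨q, hq, hm⟩ := hx
      rcases x.1.asks_eq_zero_or_exists_bestAsk with h0 | ⟨q', hq', hqq', -⟩
      · simp [bestAsk, h0] at hq
      · obtain rfl : q = q' := by rw [hq] at hqq'; exact_mod_cast hqq'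
        obtain ⟨h1, h2⟩ := hmin q hq'
        exact absurd hm (not_or.2 ⟨h1.le.not_gt, h2⟩)
  refine measurable_of_sum (fun f hf => ?_) (fun f hf => ?_)
  · have : (fun x : Book × ℝ => ((x.1.submit P (Sum.inl x.2)).bids.map f).sum) =
        fun x => if x ∈ M then (x.1.bids.map f).sum else f x.2 + (x.1.bids.map f).sum := by
      funext x
      split_ifs with hx
      · obtain ⟨s, -, hs⟩ := (hcases x).1 hx
        rw [hs]
      · rw [(hcases x).2 hx]; simp
    rw [this]
    have hs : Measurable fun x : Book × ℝ => (x.1.bids.map f).sum :=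
      (measurable_sum_bids hf).comp measurable_fst
    exact Measurable.ite hM hs ((hf.comp measurable_snd).add hs)
  · have : (fun x : Book × ℝ => ((x.1.submit P (Sum.inl x.2)).asks.map f).sum) =
        fun x => if x ∈ M then (x.1.asks.map f).sum - f x.1.bestAsk.toReal
          else (x.1.asks.map f).sum := by
      funext x
      split_ifs with hx
      · obtain ⟨s, hq, hs⟩ := (hcases x).1 hx
        have hsum := congrArg (fun m => (m.map f).sum) hq
        simp only [Multiset.map_cons, Multiset.sum_cons] at hsum
        rw [hs, hsum]
        simp
      · rw [(hcases x).2 hx]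
    rw [this]
    have hs : Measurable fun x : Book × ℝ => (x.1.asks.map f).sum :=
      (measurable_sum_asks hf).comp measurable_fst
    exact Measurable.ite hM (hs.sub (hf.comp hq)) hs

lemma measurable_submit (P : BinPartition) :
    Measurable fun x : Book × LimitOrder => x.1.submit P x.2 := by
  have h : Measurable (Sum.elim (fun x : Book × ℝ => x.1.submit P (Sum.inl x.2))
      (fun x : Book × ℝ => x.1.submit P (Sum.inr x.2))) := by
    refine (measurable_submit_inl P).sumElim ?_
    have : (fun x : Book × ℝ => x.1.submit P (Sum.inr x.2)) =
        fun x => (x.1.reflect.submit P.reflect (Sum.inl (-x.2))).reflect := by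
      funext x
      rw [← LimitOrder.reflect_inr, ← submit_reflect, reflect_reflect]
    rw [this]
    exact measurable_reflect.comp ((measurable_submit_inl P.reflect).comp
      ((measurable_reflect.comp measurable_fst).prodMk measurable_snd.neg))
  convert h.comp (MeasurableEquiv.prodSumDistrib Book ℝ ℝ).measurable using 1
  funext ⟨L, o⟩
  rcases o with p | p <;> rfl

lemma measurable_after (P : BinPartition) (n : ℕ) :
    Measurable fun o : ℕ → LimitOrder => after P o n := by
  induction n with
  | zero => exact measurable_const
  | succ n ih => exact (measurable_submit P).comp (ih.prodMk (measurable_pi_apply n))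

lemma after_congr (P : BinPartition) {o o' : ℕ → LimitOrder} {n : ℕ}
    (h : ∀ k < n, o k = o' k) : after P o n = after P o' n := by
  induction n with
  | zero => rfl
  | succ n ih => rw [after, after, ih fun k hk => h k (hk.trans n.lt_succ_self), h n n.lt_succ_self]

/-- The book before the `n`-th arrival is independent of the `n`-th order. -/
lemma indepFun_after {Ω : Type*} [MeasurableSpace Ω] {μ : Measure Ω}
    (P : BinPartition) {order : ℕ → Ω → LimitOrder} (hm : ∀ n, Measurable (order n))
    (hi : iIndepFun order μ) (n : ℕ) :
    IndepFun (fun ω => after P (fun k => order k ω) n) (order n) μ := by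
  classical
  have h := hi.indepFun_finset (Finset.range n) {n} (by simp) hm
  let φ : (Finset.range n → LimitOrder) → Book := fun r =>
    after P (fun k => if hk : k ∈ Finset.range n then r ⟨k, hk⟩ else Sum.inl 0) n
  have hφ : Measurable φ := by
    refine (measurable_after P n).comp (measurable_pi_iff.2 fun k => ?_)
    by_cases hk : k ∈ Finset.range n
    · simpa only [hk, dif_pos] using measurable_pi_apply _
    · simpa only [hk, dif_neg, not_false_eq_true] using measurable_const
  have hψ : Measurable fun r : ({n} : Finset ℕ) → LimitOrder => r ⟨n, by simp⟩ :=
    measurable_pi_apply _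
  have heq : (fun ω => after P (fun k => order k ω) n) =
      φ ∘ fun ω (i : Finset.range n) => order i ω := by
    funext ω
    exact after_congr P fun k hk => by simp [hk]
  rw [heq]
  exact h.comp hφ hψ

end Book

/-! ### A potential with drift bounded below -/

/-- The weight of a bid in the potential: `1` in the lowest price class `-1`, `θ` in the middle
class `0` and `-1` in the highest class `1`. -/
def classWeight (θ : ℝ) : SignType → ℝ
  | .neg => 1
  | .zero => θ
  | .pos => -1

namespace Book

/-- The potential of a book for a division `c` of the prices into a low, a middle and a high
class: a bid weighs `1`, `θ` or `-1` according to its class, and an ask the same in the reverse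
order of the classes. -/
def potential (θ : ℝ) (c : ℝ → SignType) (L : Book) : ℝ :=
  (L.bids.map fun p => classWeight θ (c p)).sum + (L.asks.map fun p => classWeight θ (-c p)).sum

lemma potential_reflect (θ : ℝ) (c : ℝ → SignType) (L : Book) :
    L.reflect.potential θ (fun p => -c (-p)) = L.potential θ c := by
  simp [potential, reflect, add_comm]

lemma classWeight_le_one {θ : ℝ} (hθ : θ ≤ 1) (s : SignType) : classWeight θ s ≤ 1 := by
  rcases s with _ | _ | _ <;> simp [classWeight, hθ]

lemma potential_le_card {θ : ℝ} (hθ : θ ≤ 1) (c : ℝ → SignType) (L : Book) :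
    L.potential θ c ≤ L.bids.card + L.asks.card := by
  refine add_le_add ?_ ?_
  · simpa using Multiset.sum_map_le_sum_map (s := L.bids) _ (fun _ => (1 : ℝ))
      fun p _ => classWeight_le_one hθ (c p)
  · simpa using Multiset.sum_map_le_sum_map (s := L.asks) _ (fun _ => (1 : ℝ))
      fun p _ => classWeight_le_one hθ (-c p)

/-- If bids fall into the classes with probabilities `q`, and `θ` balances these, then whatever the
book, the increment of the potential caused by an arriving bid is bounded below by a function `k`
of the class of the bid whose mean is at least `q (-1) - θ (q 0 + q 1)`. The function `k` depends
on the book only through the class of the lowest ask. -/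
lemma exists_le_potential_submit_inl (P : BinPartition) {c : ℝ → SignType} (hc : Monotone c)
    (hcP : ∀ p q, P.SameBin p q → c p = c q) {θ : ℝ} (h0 : 0 ≤ θ) (h1 : θ ≤ 1)
    {q : SignType → ℝ} (hq : ∀ s, 0 ≤ q s)
    (hθ : θ * (q .pos + 2 * q .zero) = q .pos) (L : Book) :
    ∃ k : SignType → ℝ, (∀ s, |k s| ≤ 1) ∧
      q .neg - θ * (q .zero + q .pos) ≤ q .neg * k .neg + q .zero * k .zero + q .pos * k .pos ∧
      ∀ p, L.potential θ c + k (c p) ≤ (L.submit P (Sum.inl p)).potential θ c := by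
  have habs : |θ| ≤ 1 := abs_le.2 ⟨by linarith, h1⟩
  -- the increment if the bid joins the book
  have hjoin : ∀ p, L.submit P (Sum.inl p) = ⟨p ::ₘ L.bids, L.asks⟩ →
      (L.submit P (Sum.inl p)).potential θ c = L.potential θ c + classWeight θ (c p) := by
    intro p hs
    rw [hs]; simp [potential]; ring
  -- the increment if the bid is matched with an ask at price `r`
  have hmatch : ∀ p r s, L.asks = r ::ₘ s → L.submit P (Sum.inl p) = ⟨L.bids, s⟩ →
      (L.submit P (Sum.inl p)).potential θ c = L.potential θ c - classWeight θ (-c r) := by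
    intro p r s hr hs
    rw [hs]; simp [potential, hr]; ring
  rcases L.asks_eq_zero_or_exists_bestAsk with hL | ⟨r, hr, -, hmin⟩
  · refine ⟨classWeight θ, fun s => ?_, ?_, fun p => ?_⟩
    · rcases s with _ | _ | _ <;> simp [classWeight, habs]
    · simp only [classWeight]; linarith
    · rcases submit_inl_cases P L p with ⟨r, s, hr, -⟩ | ⟨-, hs⟩
      · simp [hL] at hr
      · exact (hjoin p hs).ge
  have hle : ∀ r' s, L.asks = r' ::ₘ s → (∀ a ∈ L.asks, r' ≤ a) → r' = r := fun r' s h h' =>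
    le_antisymm (h' r hr) (hmin r' (by simp [h]))
  have hcle : ∀ p, r < p ∨ P.SameBin p r → c r ≤ c p := fun p h =>
    h.elim (fun h => hc h.le) fun h => (hcP p r h).ge
  rcases hcr : c r with _ | _ | _
  · -- lowest ask in the middle class
    refine ⟨fun s => if s = .neg then 1 else -θ, fun s => ?_, ?_, fun p => ?_⟩
    · rcases s with _ | _ | _ <;> simp [habs]
    · simp; linarith
    · rcases submit_inl_cases P L p with ⟨r', s, hr', hmin', -, hm, hs⟩ | ⟨hlt, hs⟩
      · obtain rfl := hle r' s hr' hmin'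
        have := hcle p hm
        rw [hmatch p r' s hr' hs, hcr]
        rcases hcp : c p with _ | _ | _
        · simp [classWeight]
        · rw [hcr, hcp] at this; exact absurd this (by decide)
        · simp [classWeight]
      · have := hc (hlt r hr).1.le
        rw [hjoin p hs]
        rcases hcp : c p with _ | _ | _
        · simp [classWeight]; linarith
        · simp [classWeight]
        · rw [hcr, hcp] at this; exact absurd this (by decide)
  · -- lowest ask in the lowest class
    refine ⟨fun _ => 1, by simp, ?_, fun p => ?_⟩
    · nlinarith [hq .neg, hq .zero, hq .pos]
    · rcases submit_inl_cases P L p with ⟨r', s, hr', hmin', -, hm, hs⟩ | ⟨hlt, hs⟩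
      · obtain rfl := hle r' s hr' hmin'
        rw [hmatch p r' s hr' hs, hcr]
        have : classWeight θ (-SignType.neg) = -1 := rfl
        linarith
      · have := hc (hlt r hr).1.le
        rw [hjoin p hs]
        rcases hcp : c p with _ | _ | _
        · rw [hcr, hcp] at this; exact absurd this (by decide)
        · simp [classWeight]
        · rw [hcr, hcp] at this; exact absurd this (by decide)
  · -- lowest ask in the highest class
    refine ⟨classWeight θ, fun s => ?_, ?_, fun p => ?_⟩
    · rcases s with _ | _ | _ <;> simp [classWeight, habs]
    · simp only [classWeight]; linarith
    · rcases submit_inl_cases P L p with ⟨r', s, hr', hmin', -, hm, hs⟩ | ⟨-, hs⟩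
      · obtain rfl := hle r' s hr' hmin'
        have := hcle p hm
        rw [hmatch p r' s hr' hs, hcr]
        rcases hcp : c p with _ | _ | _
        · rw [hcr, hcp] at this; exact absurd this (by decide)
        · rw [hcr, hcp] at this; exact absurd this (by decide)
        · have h1 : classWeight θ (-SignType.pos) = 1 := rfl
          have h2 : classWeight θ SignType.pos = -1 := rfl
          linarith
      · exact (hjoin p hs).ge

lemma measurableSet_class {c : ℝ → SignType} (hc : Monotone c) (s : SignType) :
    MeasurableSet {p | c p = s} :=
  ((Set.ordConnected_singleton (a := s)).preimage_mono hc).measurableSet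

/-- The exponential moment of the potential after the arrival of a bid. -/
lemma lintegral_exp_potential_submit_inl_le (P : BinPartition) {c : ℝ → SignType}
    (hc : Monotone c) (hcP : ∀ p q, P.SameBin p q → c p = c q) {θ : ℝ} (h0 : 0 ≤ θ) (h1 : θ ≤ 1)
    {q : SignType → ℝ} (hq1 : q .neg + q .zero + q .pos = 1)
    (hθ : θ * (q .pos + 2 * q .zero) = q .pos)
    (ν : Measure ℝ) [IsProbabilityMeasure ν] (hν : ∀ s, ν.real {p | c p = s} = q s)
    {l : ℝ} (hl0 : 0 ≤ l) (hl1 : l ≤ 1) (L : Book) :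
    ∫⁻ p, ENNReal.ofReal (Real.exp (-l * (L.submit P (Sum.inl p)).potential θ c)) ∂ν ≤
      ENNReal.ofReal (Real.exp (-l * L.potential θ c)) *
        ENNReal.ofReal (1 - l * (q .neg - θ * (q .zero + q .pos)) + l ^ 2) := by
  have hq : ∀ s, 0 ≤ q s := fun s => hν s ▸ measureReal_nonneg
  obtain ⟨k, hk1, hkq, hk⟩ := exists_le_potential_submit_inl P hc hcP h0 h1 hq hθ L
  set A := Real.exp (-l * L.potential θ c)
  have hA : 0 ≤ A := (Real.exp_pos _).le
  have hexp : ∀ s, Real.exp (-l * k s) ≤ 1 - l * k s + l ^ 2 := fun s => by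
    have hs := abs_le.1 (hk1 s)
    have habs : |-l * k s| ≤ 1 := by
      rw [abs_mul, abs_neg, abs_of_nonneg hl0]
      exact mul_le_one₀ hl1 (abs_nonneg _) (hk1 s)
    have := (abs_le.1 (Real.abs_exp_sub_one_sub_id_le habs)).2
    have h2 : (-l * k s) ^ 2 ≤ l ^ 2 := by
      rw [mul_pow, neg_sq]
      exact mul_le_of_le_one_right (sq_nonneg l) (by nlinarith)
    linarith
  calc ∫⁻ p, ENNReal.ofReal (Real.exp (-l * (L.submit P (Sum.inl p)).potential θ c)) ∂ν
      ≤ ∫⁻ p, ∑ s : SignType, {p | c p = s}.indicator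
          (fun _ => ENNReal.ofReal (A * Real.exp (-l * k s))) p ∂ν := by
        refine lintegral_mono fun p => ?_
        rw [Finset.sum_eq_single (c p) (fun s _ hs => Set.indicator_of_notMem
          (s := {p | c p = s}) (fun h => hs h.symm) _) (by simp),
          Set.indicator_of_mem (s := {p' | c p' = c p}) rfl, ← Real.exp_add]
        refine ENNReal.ofReal_le_ofReal (Real.exp_le_exp.2 ?_)
        nlinarith [hk p]
    _ = ∑ s : SignType, ENNReal.ofReal (A * Real.exp (-l * k s)) * ν {p | c p = s} := by
        rw [lintegral_finsetSum _ fun s _ =>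
          measurable_const.indicator (measurableSet_class hc s)]
        exact Finset.sum_congr rfl fun s _ => lintegral_indicator_const (measurableSet_class hc s) _
    _ = ENNReal.ofReal (∑ s : SignType, A * Real.exp (-l * k s) * q s) := by
        rw [ENNReal.ofReal_sum_of_nonneg fun s _ =>
          mul_nonneg (mul_nonneg hA (Real.exp_pos _).le) (hq s)]
        refine Finset.sum_congr rfl fun s _ => ?_
        rw [ENNReal.ofReal_mul (mul_nonneg hA (Real.exp_pos _).le), ← hν s,
          ofReal_measureReal]
    _ ≤ ENNReal.ofReal (A * (1 - l * (q .neg - θ * (q .zero + q .pos)) + l ^ 2)) := by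
        refine ENNReal.ofReal_le_ofReal ?_
        have hsum : ∀ f : SignType → ℝ, ∑ s, f s = f .neg + f .zero + f .pos := fun f => by
          rw [show (Finset.univ : Finset SignType) = {.neg, .zero, .pos} by decide,
            Finset.sum_insert (by decide), Finset.sum_pair (by decide)]
          ring
        simp only [mul_assoc]
        rw [← Finset.mul_sum]
        refine mul_le_mul_of_nonneg_left ?_ hA
        rw [hsum]
        have := mul_le_mul_of_nonneg_right (hexp .neg) (hq .neg)
        have := mul_le_mul_of_nonneg_right (hexp .zero) (hq .zero)
        have := mul_le_mul_of_nonneg_right (hexp .pos) (hq .pos)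
        have := mul_le_mul_of_nonneg_left hkq hl0
        nlinarith
    _ = _ := ENNReal.ofReal_mul hA

lemma measurable_potential {c : ℝ → SignType} (hc : Monotone c) (θ : ℝ) :
    Measurable (potential θ c) := by
  have h : ∀ φ : SignType → ℝ, Measurable fun p => φ (c p) := fun φ => by
    let _ : MeasurableSpace SignType := ⊤
    have : Measurable c := measurable_to_countable' fun s => measurableSet_class hc s
    exact (measurable_from_top (f := φ)).comp this
  exact (measurable_sum_bids (h _)).add (measurable_sum_asks (h fun s => classWeight θ (-s)))

lemma lintegral_orderLaw (νb νa : Measure ℝ) {f : LimitOrder → ENNReal} (hf : Measurable f) :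
    ∫⁻ o, f o ∂orderLaw νb νa =
      2⁻¹ * ∫⁻ p, f (Sum.inl p) ∂νb + 2⁻¹ * ∫⁻ p, f (Sum.inr p) ∂νa := by
  rw [orderLaw, lintegral_add_measure, lintegral_smul_measure, lintegral_smul_measure,
    lintegral_map hf measurable_inl, lintegral_map hf measurable_inr]
  rfl

/-- The exponential moment of the potential after the arrival of a random order. -/
lemma lintegral_exp_potential_submit_le (P : BinPartition) {c : ℝ → SignType}
    (hc : Monotone c) (hcP : ∀ p q, P.SameBin p q → c p = c q) {θ : ℝ} (h0 : 0 ≤ θ) (h1 : θ ≤ 1)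
    {q : SignType → ℝ} (hq1 : q .neg + q .zero + q .pos = 1)
    (hθ : θ * (q .pos + 2 * q .zero) = q .pos)
    (νb νa : Measure ℝ) [IsProbabilityMeasure νb] [IsProbabilityMeasure νa]
    (hb : ∀ s, νb.real {p | c p = s} = q s) (ha : ∀ s, νa.real {p | -c p = s} = q s)
    {l : ℝ} (hl0 : 0 ≤ l) (hl1 : l ≤ 1) (L : Book) :
    ∫⁻ o, ENNReal.ofReal (Real.exp (-l * (L.submit P o).potential θ c)) ∂orderLaw νb νa ≤
      ENNReal.ofReal (Real.exp (-l * L.potential θ c)) *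
        ENNReal.ofReal (1 - l * (q .neg - θ * (q .zero + q .pos)) + l ^ 2) := by
  have hbid := lintegral_exp_potential_submit_inl_le P hc hcP h0 h1 hq1 hθ νb hb hl0 hl1 L
  -- the ask side is the bid side of the reflected book
  have hc' : Monotone fun p => -c (-p) := fun a b hab =>
    (by decide : ∀ s t : SignType, s ≤ t → -t ≤ -s) _ _ (hc (neg_le_neg hab))
  have := Measure.isProbabilityMeasure_map (μ := νa) (f := Neg.neg) measurable_neg.aemeasurable
  have hask := lintegral_exp_potential_submit_inl_le P.reflect hc'
    (fun p q h => congrArg Neg.neg (hcP _ _ (BinPartition.reflect_sameBin.1 h)))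
    h0 h1 hq1 hθ (νa.map Neg.neg)
    (fun s => by
      rw [map_measureReal_apply measurable_neg (measurableSet_class hc' s), ← ha s]
      simp) hl0 hl1 L.reflect
  have hF : ∀ (P : BinPartition) (L : Book) {c : ℝ → SignType}, Monotone c →
      Measurable fun o => ENNReal.ofReal (Real.exp (-l * (L.submit P o).potential θ c)) :=
    fun P L c hc => (Real.measurable_exp.comp (((measurable_potential hc θ).comp
      ((measurable_submit P).comp (measurable_const.prodMk measurable_id))).const_mul
        _)).ennreal_ofReal
  have hF' : Measurable fun p => ENNReal.ofReal (Real.exp (-l *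
      (L.reflect.submit P.reflect (Sum.inl p)).potential θ fun p => -c (-p))) :=
    (hF P.reflect L.reflect hc').comp measurable_inl
  rw [lintegral_map hF' measurable_neg, potential_reflect] at hask
  have heq : ∀ p, (L.reflect.submit P.reflect (Sum.inl (-p))).potential θ (fun p => -c (-p)) =
      (L.submit P (Sum.inr p)).potential θ c := fun p => by
    rw [← potential_reflect θ c (L.submit P (Sum.inr p)), submit_reflect, LimitOrder.reflect_inr]
  simp only [heq] at hask
  rw [lintegral_orderLaw νb νa (hF P L hc)]
  refine (add_le_add (mul_le_mul_right hbid _) (mul_le_mul_right hask _)).trans ?_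
  rw [← add_mul, ENNReal.inv_two_add_inv_two, one_mul]

/-- The potential grows almost surely at least at the rate given by its minimal drift. The
exponential moments of its deviation decay geometrically, so that the Borel–Cantelli lemma
applies. -/
lemma ae_eventually_le_potential (P : BinPartition) {c : ℝ → SignType}
    (hc : Monotone c) (hcP : ∀ p q, P.SameBin p q → c p = c q) {θ : ℝ} (h0 : 0 ≤ θ) (h1 : θ ≤ 1)
    {q : SignType → ℝ} (hq1 : q .neg + q .zero + q .pos = 1)
    (hθ : θ * (q .pos + 2 * q .zero) = q .pos)
    (νb νa : Measure ℝ) [IsProbabilityMeasure νb] [IsProbabilityMeasure νa]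
    (hb : ∀ s, νb.real {p | c p = s} = q s) (ha : ∀ s, νa.real {p | -c p = s} = q s)
    {Ω : Type*} [MeasurableSpace Ω] {μ : Measure Ω} [IsProbabilityMeasure μ]
    {order : ℕ → Ω → LimitOrder} (hm : ∀ n, Measurable (order n)) (hi : iIndepFun order μ)
    (hlaw : ∀ n, μ.map (order n) = orderLaw νb νa) {ε : ℝ} (hε : 0 < ε) :
    ∀ᵐ ω ∂μ, ∀ᶠ n : ℕ in atTop,
      (q .neg - θ * (q .zero + q .pos) - ε) * n ≤
        (after P (fun k => order k ω) n).potential θ c := by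
  set v := q .neg - θ * (q .zero + q .pos)
  -- this exponent makes the rate `-l * ε + l ^ 2` negative
  set l := min 1 (ε / 2) with hl
  have hl0 : 0 < l := lt_min one_pos (by linarith)
  have hl1 : l ≤ 1 := min_le_left _ _
  have hlε : l ≤ ε / 2 := min_le_right _ _
  let G : ℕ → Ω → ENNReal := fun n ω =>
    ENNReal.ofReal (Real.exp (-l * (after P (fun k => order k ω) n).potential θ c))
  have hBm : ∀ n, Measurable fun ω => after P (fun k => order k ω) n := fun n =>
    (measurable_after P n).comp (measurable_pi_iff.2 hm)
  have hf : Measurable fun L : Book => ENNReal.ofReal (Real.exp (-l * L.potential θ c)) :=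
    (Real.measurable_exp.comp ((measurable_potential hc θ).const_mul _)).ennreal_ofReal
  have hG : ∀ n, Measurable (G n) := fun n => hf.comp (hBm n)
  have hE : ∀ n, ∫⁻ ω, G n ω ∂μ ≤ ENNReal.ofReal (Real.exp (-l * v + l ^ 2)) ^ n := by
    intro n
    induction n with
    | zero => simp [G, after, empty, potential]
    | succ n ih =>
      have hjoint := (indepFun_iff_map_prod_eq_prod_map_map (hBm n).aemeasurable
        (hm n).aemeasurable).1 (indepFun_after P hm hi n)
      have := Measure.isProbabilityMeasure_map (μ := μ) (hm n).aemeasurable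
      have := Measure.isProbabilityMeasure_map (μ := μ) (hBm n).aemeasurable
      have hfs : Measurable fun x : Book × LimitOrder =>
          ENNReal.ofReal (Real.exp (-l * (x.1.submit P x.2).potential θ c)) :=
        hf.comp (measurable_submit P)
      calc ∫⁻ ω, G (n + 1) ω ∂μ
          = ∫⁻ x, ENNReal.ofReal (Real.exp (-l * (x.1.submit P x.2).potential θ c))
              ∂(μ.map fun ω => (after P (fun k => order k ω) n, order n ω)) :=
            (lintegral_map hfs ((hBm n).prodMk (hm n))).symm
        _ = ∫⁻ L, ∫⁻ o, ENNReal.ofReal (Real.exp (-l * (L.submit P o).potential θ c))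
              ∂orderLaw νb νa ∂(μ.map fun ω => after P (fun k => order k ω) n) := by
            rw [hjoint, lintegral_prod _ hfs.aemeasurable, hlaw n]
        _ ≤ ∫⁻ L, ENNReal.ofReal (Real.exp (-l * L.potential θ c)) *
              ENNReal.ofReal (Real.exp (-l * v + l ^ 2))
              ∂(μ.map fun ω => after P (fun k => order k ω) n) := by
            refine lintegral_mono fun L => ?_
            refine (lintegral_exp_potential_submit_le P hc hcP h0 h1 hq1 hθ νb νa hb ha hl0.le hl1
              L).trans (mul_le_mul_right (ENNReal.ofReal_le_ofReal ?_) _)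
            have := Real.add_one_le_exp (-l * v + l ^ 2)
            linarith
        _ ≤ ENNReal.ofReal (Real.exp (-l * v + l ^ 2)) ^ (n + 1) := by
            rw [lintegral_mul_const _ hf, lintegral_map hf (hBm n), pow_succ]
            exact mul_le_mul_left ih _
  have hbound : ∀ n : ℕ, μ {ω | (after P (fun k => order k ω) n).potential θ c < (v - ε) * n} ≤
      ENNReal.ofReal (Real.exp (-l * ε + l ^ 2)) ^ n := by
    intro n
    set a := Real.exp (-l * (v - ε)) ^ n with ha
    have ha0 : 0 < a := pow_pos (Real.exp_pos _) n
    calc μ {ω | (after P (fun k => order k ω) n).potential θ c < (v - ε) * n}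
        ≤ μ {ω | ENNReal.ofReal a ≤ G n ω} := by
          refine measure_mono fun ω hω => ENNReal.ofReal_le_ofReal ?_
          rw [ha, ← Real.exp_nat_mul, Real.exp_le_exp]
          have : (after P (fun k => order k ω) n).potential θ c < (v - ε) * n := hω
          nlinarith
      _ ≤ (∫⁻ ω, G n ω ∂μ) / ENNReal.ofReal a :=
          meas_ge_le_lintegral_div (hG n).aemeasurable (by simpa using ha0) ENNReal.ofReal_ne_top
      _ ≤ ENNReal.ofReal (Real.exp (-l * v + l ^ 2)) ^ n / ENNReal.ofReal a := by
          gcongr; exact hE n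
      _ = ENNReal.ofReal (Real.exp (-l * ε + l ^ 2)) ^ n := by
          rw [← ENNReal.ofReal_pow (Real.exp_pos _).le, ← ENNReal.ofReal_pow (Real.exp_pos _).le,
            ← ENNReal.ofReal_div_of_pos ha0, ha, ← div_pow, ← Real.exp_sub]
          ring_nf
  have hr : ENNReal.ofReal (Real.exp (-l * ε + l ^ 2)) < 1 := by
    rw [ENNReal.ofReal_lt_one, Real.exp_lt_one_iff]
    nlinarith
  have hsum : ∑' n, μ {ω | (after P (fun k => order k ω) n).potential θ c < (v - ε) * n} ≠ ⊤ := by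
    refine ((ENNReal.tsum_le_tsum hbound).trans_lt ?_).ne
    rw [ENNReal.tsum_geometric, ENNReal.inv_lt_top]
    exact tsub_pos_of_lt hr
  filter_upwards [ae_eventually_notMem hsum] with ω hω
  filter_upwards [hω] with n hn
  exact not_lt.1 hn

end Book

/-! ### Arrival rates -/

lemma le_of_frequently_le_add {A B : ℕ → ℝ} {a b : ℝ} (C : ℝ)
    (hA : Tendsto (fun n => A n / n) atTop (nhds a))
    (hB : Tendsto (fun n => B n / n) atTop (nhds b)) (h : ∃ᶠ n in atTop, A n ≤ B n + C) :
    a ≤ b := by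
  have hC : Tendsto (fun n : ℕ => C / n) atTop (nhds 0) := tendsto_const_div_atTop_nhds_zero_nat C
  have := le_of_tendsto_of_frequently (b := 0) ((hA.sub hB).sub hC) (h.mono fun n hn => by
    rw [← sub_div, ← sub_div]
    exact div_nonpos_of_nonpos_of_nonneg (by linarith) n.cast_nonneg)
  linarith

lemma integral_orderLaw {νb νa : Measure ℝ} {f g : ℝ → ℝ} (hf : Integrable f νb)
    (hg : Integrable g νa) (hfm : Measurable f) (hgm : Measurable g) :
    Integrable (Sum.elim f g) (orderLaw νb νa) ∧
      ∫ o, Sum.elim f g o ∂orderLaw νb νa = (∫ p, f p ∂νb + ∫ p, g p ∂νa) / 2 := by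
  have hm : Measurable (Sum.elim f g) := hfm.sumElim hgm
  have hb : Integrable (Sum.elim f g) (νb.map Sum.inl) :=
    (integrable_map_measure hm.aestronglyMeasurable measurable_inl.aemeasurable).2 hf
  have ha : Integrable (Sum.elim f g) (νa.map Sum.inr) :=
    (integrable_map_measure hm.aestronglyMeasurable measurable_inr.aemeasurable).2 hg
  have hb' := hb.smul_measure (c := 2⁻¹) (by simp)
  have ha' := ha.smul_measure (c := 2⁻¹) (by simp)
  refine ⟨hb'.add_measure ha', ?_⟩
  rw [orderLaw, integral_add_measure hb' ha', integral_smul_measure, integral_smul_measure,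
    integral_map measurable_inl.aemeasurable hm.aestronglyMeasurable,
    integral_map measurable_inr.aemeasurable hm.aestronglyMeasurable]
  simp
  ring

namespace IsOrderFlow

variable {Ω : Type*} [MeasurableSpace Ω] {μ : Measure Ω}
  {order : ℕ → Ω → LimitOrder} {time : ℕ → Ω → ℝ} {νb νa : Measure ℝ}

lemma ae_tendsto_sum_div (h : IsOrderFlow μ order time νb νa) {f g : ℝ → ℝ}
    (hf : Integrable f νb) (hg : Integrable g νa) (hfm : Measurable f) (hgm : Measurable g) :
    ∀ᵐ ω ∂μ, Tendsto (fun n : ℕ => (∑ k ∈ Finset.range n, Sum.elim f g (order k ω)) / n) atTop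
      (nhds ((∫ p, f p ∂νb + ∫ p, g p ∂νa) / 2)) := by
  have hm : Measurable (Sum.elim f g) := hfm.sumElim hgm
  obtain ⟨hint, heq⟩ := integral_orderLaw hf hg hfm hgm
  have hlaw : ∫ ω, Sum.elim f g (order 0 ω) ∂μ = (∫ p, f p ∂νb + ∫ p, g p ∂νa) / 2 := by
    rw [← heq, ← h.law 0,
      integral_map (h.measurable_order 0).aemeasurable hm.aestronglyMeasurable]
  rw [← hlaw]
  refine strong_law_ae_real (fun n ω => Sum.elim f g (order n ω)) ?_ ?_ ?_
  · rw [← h.law 0] at hint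
    exact hint.comp_measurable (h.measurable_order 0)
  · exact fun i j hij => (h.indep.indepFun hij).comp hm hm
  · intro i
    exact (IdentDistrib.mk (h.measurable_order i).aemeasurable (h.measurable_order 0).aemeasurable
      ((h.law i).trans (h.law 0).symm)).comp hm

lemma ae_tendsto_bids [IsProbabilityMeasure νb] (h : IsOrderFlow μ order time νb νa)
    {S : Set ℝ} (hS : MeasurableSet S) :
    ∀ᵐ ω ∂μ, Tendsto
      (fun n : ℕ => (∑ k ∈ Finset.range n, Sum.elim (S.indicator 1) 0 (order k ω)) / (n : ℝ)) atTop
      (nhds (νb.real S / 2)) := by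
  have := h.ae_tendsto_sum_div (f := S.indicator 1) (g := 0)
    ((integrable_const (1 : ℝ)).indicator hS) (integrable_zero _ _ _)
    (measurable_one.indicator hS) measurable_zero
  simpa [integral_indicator_one hS] using this

lemma ae_tendsto_asks [IsProbabilityMeasure νa] (h : IsOrderFlow μ order time νb νa)
    {S : Set ℝ} (hS : MeasurableSet S) :
    ∀ᵐ ω ∂μ, Tendsto
      (fun n : ℕ => (∑ k ∈ Finset.range n, Sum.elim 0 (S.indicator 1) (order k ω)) / (n : ℝ)) atTop
      (nhds (νa.real S / 2)) := by
  have := h.ae_tendsto_sum_div (f := 0) (g := S.indicator 1)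
    (integrable_zero _ _ _) ((integrable_const (1 : ℝ)).indicator hS)
    measurable_zero (measurable_one.indicator hS)
  simpa [integral_indicator_one hS] using this

/-- Up to an error of smaller order than `n`, the book holds as many bids as asks. -/
lemma ae_tendsto_card_sub_card [IsProbabilityMeasure νb] [IsProbabilityMeasure νa]
    (h : IsOrderFlow μ order time νb νa) (P : BinPartition) :
    ∀ᵐ ω ∂μ, Tendsto (fun n : ℕ => (((Book.after P (fun k => order k ω) n).bids.card : ℝ) -
      (Book.after P (fun k => order k ω) n).asks.card) / n) atTop (nhds 0) := by
  have := h.ae_tendsto_sum_div (f := fun _ => 1) (g := fun _ => -1)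
    (integrable_const _) (integrable_const _) measurable_const measurable_const
  simpa [Book.card_bids_sub_card_asks] using this

end IsOrderFlow

/-! ### Thresholds in terms of the number of arrivals -/

lemma frequently_ncard_le_iff {τ : ℕ → ℝ} (hτ : StrictMono τ) (hτ' : Tendsto τ atTop atTop)
    (Q : ℕ → Prop) :
    (∃ᶠ t in atTop, Q (Set.ncard {n | τ n ≤ t})) ↔ ∃ᶠ n in atTop, Q n := by
  have hfin : ∀ t, {n | τ n ≤ t}.Finite := fun t => by
    obtain ⟨N, hN⟩ := (hτ'.eventually_gt_atTop t).exists_forall_of_atTop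
    exact (Set.finite_lt_nat N).subset fun n hn =>
      not_le.1 fun hle => (hN n hle).not_ge hn
  have hN : ∀ n, Set.ncard {k | τ k ≤ τ n} = n + 1 := fun n => by
    have : {k | τ k ≤ τ n} = (Finset.range (n + 1) : Set ℕ) := by
      ext k
      simp [hτ.le_iff_le]
    rw [this, Set.ncard_coe_finset, Finset.card_range]
  constructor
  · refine fun h => Tendsto.frequently (f := fun t => Set.ncard {n | τ n ≤ t}) ?_ h
    refine tendsto_atTop.2 fun b => (eventually_ge_atTop (τ b)).mono fun t ht => ?_
    have := Set.ncard_le_ncard (fun k (hk : τ k ≤ τ b) => hk.trans ht) (hfin t)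
    exact (Nat.le_succ b).trans ((hN b).ge.trans this)
  · intro h h'
    obtain ⟨N, hN'⟩ := (hτ'.eventually h').exists_forall_of_atTop
    refine h (eventually_atTop.2 ⟨N + 1, fun m hm => ?_⟩)
    obtain ⟨m, rfl⟩ : ∃ k, m = k + 1 := ⟨m - 1, by omega⟩
    rw [← hN m]
    exact hN' m (by omega)

section

variable {Ω : Type*} [MeasurableSpace Ω] {μ : Measure Ω} {P : BinPartition}
  {order : ℕ → Ω → LimitOrder} {time : ℕ → Ω → ℝ} {νb νa : Measure ℝ}

lemma IsOrderFlow.ae_frequently_highestBid_iff (h : IsOrderFlow μ order time νb νa) :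
    ∀ᵐ ω ∂μ, ∀ x : EReal, (∃ᶠ t in atTop, highestBid P order time t ω < x) ↔
      ∃ᶠ n in atTop, (Book.after P (fun k => order k ω) n).bestBid < x := by
  filter_upwards [h.time_strictMono, h.time_tendsto] with ω h1 h2 x
  exact frequently_ncard_le_iff h1 h2
    fun n => (Book.after P (fun k => order k ω) n).bestBid < x

lemma IsOrderFlow.ae_frequently_lowestAsk_iff (h : IsOrderFlow μ order time νb νa) :
    ∀ᵐ ω ∂μ, ∀ x : EReal, (∃ᶠ t in atTop, x < lowestAsk P order time t ω) ↔
      ∃ᶠ n in atTop, x < (Book.after P (fun k => order k ω) n).bestAsk := by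
  filter_upwards [h.time_strictMono, h.time_tendsto] with ω h1 h2 x
  exact frequently_ncard_le_iff h1 h2
    fun n => x < (Book.after P (fun k => order k ω) n).bestAsk

/-- Below the bid threshold there is a positive probability that from some time on the highest bid
stays above the level. Then all bids below the level that arrive later stay in the book. -/
lemma IsOrderFlow.frequently_le_card_bids (h : IsOrderFlow μ order time νb νa) {z : ℝ}
    (hz : (z : EReal) < bidThreshold μ P order time) :
    ∃ᶠ ω in ae μ, ∃ N : ℕ, ∀ n,
      ∑ k ∈ Finset.range n, Sum.elim ((Set.Iio z).indicator 1) 0 (order k ω) - N ≤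
        ((Book.after P (fun k => order k ω) n).bids.card : ℝ) := by
  have hn : ∃ᶠ ω in ae μ, ¬ ∃ᶠ t in atTop, highestBid P order time t ω < z :=
    not_eventually.1 fun hz' => not_lt.2 (sInf_le (a := (z : EReal))
      (s := {x : EReal | ∀ᵐ ω ∂μ, ∃ᶠ t in atTop, highestBid P order time t ω < x}) hz') hz
  refine (hn.and_eventually (h.ae_frequently_highestBid_iff (P := P))).mono fun ω hω => ?_
  rw [hω.2, not_frequently] at hω
  obtain ⟨N, hN⟩ := hω.1.exists_forall_of_atTop
  exact ⟨N, Book.le_card_bids_of_le_bestBid P _ fun n hn => not_lt.1 (hN n hn)⟩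

lemma IsOrderFlow.frequently_le_card_asks (h : IsOrderFlow μ order time νb νa) {z : ℝ}
    (hz : askThreshold μ P order time < z) :
    ∃ᶠ ω in ae μ, ∃ N : ℕ, ∀ n,
      ∑ k ∈ Finset.range n, Sum.elim 0 ((Set.Ioi z).indicator 1) (order k ω) - N ≤
        ((Book.after P (fun k => order k ω) n).asks.card : ℝ) := by
  have hn : ∃ᶠ ω in ae μ, ¬ ∃ᶠ t in atTop, (z : EReal) < lowestAsk P order time t ω :=
    not_eventually.1 fun hz' => not_lt.2 (le_sSup (a := (z : EReal))
      (s := {x : EReal | ∀ᵐ ω ∂μ, ∃ᶠ t in atTop, x < lowestAsk P order time t ω}) hz') hz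
  refine (hn.and_eventually (h.ae_frequently_lowestAsk_iff (P := P))).mono fun ω hω => ?_
  rw [hω.2, not_frequently] at hω
  obtain ⟨N, hN⟩ := hω.1.exists_forall_of_atTop
  exact ⟨N, Book.le_card_asks_of_bestAsk_le P _ fun n hn => not_lt.1 (hN n hn)⟩

/-- Above the bid threshold, infinitely often all bids in the book are below the level. -/
lemma IsOrderFlow.ae_frequently_card_bids_le (h : IsOrderFlow μ order time νb νa) {z : ℝ}
    (hz : bidThreshold μ P order time < z) :
    ∀ᵐ ω ∂μ, ∃ᶠ n in atTop, ((Book.after P (fun k => order k ω) n).bids.card : ℝ) ≤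
      ∑ k ∈ Finset.range n, Sum.elim ((Set.Iio z).indicator 1) 0 (order k ω) := by
  obtain ⟨x, hx, hxz⟩ := sInf_lt_iff.1 hz
  filter_upwards [hx, h.ae_frequently_highestBid_iff (P := P)] with ω h1 h2
  refine ((h2 x).1 h1).mono fun n hn => Book.card_bids_le_of_forall_mem P _ fun b hb => ?_
  exact EReal.coe_lt_coe_iff.1 (((Book.le_bestBid hb).trans_lt hn).trans hxz)

lemma IsOrderFlow.ae_frequently_card_asks_le (h : IsOrderFlow μ order time νb νa) {z : ℝ}
    (hz : (z : EReal) < askThreshold μ P order time) :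
    ∀ᵐ ω ∂μ, ∃ᶠ n in atTop, ((Book.after P (fun k => order k ω) n).asks.card : ℝ) ≤
      ∑ k ∈ Finset.range n, Sum.elim 0 ((Set.Ioi z).indicator 1) (order k ω) := by
  obtain ⟨x, hx, hxz⟩ := lt_sSup_iff.1 hz
  filter_upwards [hx, h.ae_frequently_lowestAsk_iff (P := P)] with ω h1 h2
  refine ((h2 x).1 h1).mono fun n hn => Book.card_asks_le_of_forall_mem P _ fun b hb => ?_
  exact EReal.coe_lt_coe_iff.1 (hxz.trans (hn.trans_le (Book.bestAsk_le hb)))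

variable [IsProbabilityMeasure νb] [IsProbabilityMeasure νa]

/-! ### Comparison of rates at the thresholds -/

/-- At times when all asks are above `w`, there are no more asks in the book than arrived above
`w`; there are as many bids, among them all but finitely many of those that arrived below `z`. -/
lemma IsOrderFlow.measure_Iio_le_measure_Ioi (h : IsOrderFlow μ order time νb νa) {z w : ℝ}
    (hz : (z : EReal) < bidThreshold μ P order time)
    (hw : (w : EReal) < askThreshold μ P order time) :
    νb.real (Set.Iio z) ≤ νa.real (Set.Ioi w) := by
  obtain ⟨ω, ⟨N, hN⟩, hf, hb, ha, hd⟩ := ((h.frequently_le_card_bids hz).and_eventually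
    ((h.ae_frequently_card_asks_le hw).and ((h.ae_tendsto_bids (S := Set.Iio z)
      measurableSet_Iio).and ((h.ae_tendsto_asks (S := Set.Ioi w) measurableSet_Ioi).and
        (h.ae_tendsto_card_sub_card P))))).exists
  have := le_of_frequently_le_add N hb (by simpa only [← add_div] using ha.add hd)
    (hf.mono fun n hn => by linarith [hN n])
  linarith

lemma IsOrderFlow.measure_Ioi_le_measure_Iio (h : IsOrderFlow μ order time νb νa) {z w : ℝ}
    (hz : bidThreshold μ P order time < z) (hw : askThreshold μ P order time < w) :
    νa.real (Set.Ioi w) ≤ νb.real (Set.Iio z) := by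
  obtain ⟨ω, ⟨N, hN⟩, hf, hb, ha, hd⟩ := ((h.frequently_le_card_asks hw).and_eventually
    ((h.ae_frequently_card_bids_le hz).and ((h.ae_tendsto_bids (S := Set.Iio z)
      measurableSet_Iio).and ((h.ae_tendsto_asks (S := Set.Ioi w) measurableSet_Ioi).and
        (h.ae_tendsto_card_sub_card P))))).exists
  have := le_of_frequently_le_add N ha (by simpa only [← sub_div] using hb.sub hd)
    (hf.mono fun n hn => by linarith [hN n])
  linarith

/-- Bids above `y` and asks up to `x < y` are never in the book together, which bounds the growth
of the book. -/
lemma IsOrderFlow.measure_Iio_le_of_lt_bidThreshold (h : IsOrderFlow μ order time νb νa)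
    {x y z : ℝ} (hxy : x < y) (hbal : νa.real (Set.Ioi x) = νb.real (Set.Iic y))
    (hz : (z : EReal) < bidThreshold μ P order time) :
    νb.real (Set.Iio z) ≤ νb.real (Set.Iic y) := by
  obtain ⟨ω, ⟨N, hN⟩, hb, hby, hax, hd⟩ := ((h.frequently_le_card_bids hz).and_eventually
    ((h.ae_tendsto_bids (S := Set.Iio z) measurableSet_Iio).and
      ((h.ae_tendsto_bids (S := Set.Iic y) measurableSet_Iic).and
        ((h.ae_tendsto_asks (S := Set.Ioi x) measurableSet_Ioi).and
          (h.ae_tendsto_card_sub_card P))))).exists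
  have hcases : ∀ n, (∀ b ∈ (Book.after P (fun k => order k ω) n).bids, b ∈ Set.Iic y) ∨
      ∀ a ∈ (Book.after P (fun k => order k ω) n).asks, a ∈ Set.Ioi x := fun n => by
    by_contra! hcon
    obtain ⟨⟨b, hb, hby⟩, a, ha, hax⟩ := hcon
    have := (Book.separated_after P _ n b hb a ha).1
    simp only [Set.mem_Iic, Set.mem_Ioi, not_le, not_lt] at hby hax
    linarith
  rcases frequently_or_distrib.1 (Frequently.of_forall hcases (f := atTop)) with hf | hf
  · have := le_of_frequently_le_add N hb hby (hf.mono fun n hn => by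
      linarith [hN n, Book.card_bids_le_of_forall_mem P _ hn])
    linarith
  · have := le_of_frequently_le_add N hb (by simpa only [← add_div] using hax.add hd)
      (hf.mono fun n hn => by linarith [hN n, Book.card_asks_le_of_forall_mem P _ hn])
    linarith

/-- The growth rate of the potential is a lower bound for the growth rate of the book, which at
times when all bids are below `z` is at most the arrival rate of such bids. -/
lemma IsOrderFlow.drift_le_measure_Iio [IsProbabilityMeasure μ] (h : IsOrderFlow μ order time νb νa)
    {c : ℝ → SignType} (hc : Monotone c) (hcP : ∀ p q, P.SameBin p q → c p = c q)
    {θ : ℝ} (h0 : 0 ≤ θ) (h1 : θ ≤ 1)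
    {q : SignType → ℝ} (hq1 : q .neg + q .zero + q .pos = 1)
    (hθ : θ * (q .pos + 2 * q .zero) = q .pos)
    (hb : ∀ s, νb.real {p | c p = s} = q s) (ha : ∀ s, νa.real {p | -c p = s} = q s) {z : ℝ}
    (hz : bidThreshold μ P order time < z) :
    q .neg - θ * (q .zero + q .pos) ≤ νb.real (Set.Iio z) := by
  refine le_of_forall_pos_sub_le fun ε hε => ?_
  obtain ⟨ω, hf, hbz, hd, hg⟩ := ((h.ae_frequently_card_bids_le hz).and
    ((h.ae_tendsto_bids (S := Set.Iio z) measurableSet_Iio).and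
      ((h.ae_tendsto_card_sub_card P).and (Book.ae_eventually_le_potential P hc hcP h0 h1 hq1 hθ
        νb νa hb ha h.measurable_order h.indep h.law hε)))).exists
  have hlin : Tendsto (fun n : ℕ => (q .neg - θ * (q .zero + q .pos) - ε) * n / n) atTop
      (nhds (q .neg - θ * (q .zero + q .pos) - ε)) :=
    tendsto_const_nhds.congr' ((eventually_ne_atTop 0).mono fun n hn => by
      exact (mul_div_cancel_right₀ _ (Nat.cast_ne_zero.2 hn)).symm)
  have := le_of_frequently_le_add 0 hlin
    (by simpa only [← add_div, ← sub_div] using (hbz.add hbz).sub hd)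
    ((hf.and_eventually hg).mono fun n hn => by
      linarith [hn.1, hn.2, Book.potential_le_card h1 c (Book.after P (fun k => order k ω) n)])
  linarith

end

/-! ### Distribution functions at the thresholds -/

lemma measureReal_coe_lt_le {ν : Measure ℝ} [IsProbabilityMeasure ν] {κ : EReal} {a : ℝ}
    (ha : 0 ≤ a) (h : ∀ z : ℝ, (z : EReal) < κ → ν.real (Set.Iio z) ≤ a) :
    ν.real {p : ℝ | (p : EReal) < κ} ≤ a := by
  have hU : {p : ℝ | (p : EReal) < κ} =
      ⋃ r : {r : ℚ // ((r : ℝ) : EReal) < κ}, Set.Iio ((r : ℚ) : ℝ) := by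
    ext p
    simp only [Set.mem_ofPred_eq, Set.mem_iUnion, Set.mem_Iio, Subtype.exists]
    constructor
    · intro hp
      obtain ⟨r, hr1, hr2⟩ := EReal.lt_iff_exists_rat_btwn.1 hp
      exact ⟨r, hr2, EReal.coe_lt_coe_iff.1 hr1⟩
    · rintro ⟨r, hr, hpr⟩
      exact (EReal.coe_lt_coe_iff.2 hpr).trans hr
  have hdir : Directed (· ⊆ ·)
      fun r : {r : ℚ // ((r : ℝ) : EReal) < κ} => Set.Iio ((r : ℚ) : ℝ) :=
    Monotone.directed_le fun r s hrs => Set.Iio_subset_Iio (by exact_mod_cast hrs)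
  rw [measureReal_def, hU, hdir.measure_iUnion]
  refine ENNReal.toReal_le_of_le_ofReal ha (iSup_le fun r => ?_)
  rw [← ofReal_measureReal]
  exact ENNReal.ofReal_le_ofReal (h _ r.2)

lemma measureReal_lt_coe_le {ν : Measure ℝ} [IsProbabilityMeasure ν] {κ : EReal} {a : ℝ}
    (ha : 0 ≤ a) (h : ∀ z : ℝ, κ < z → ν.real (Set.Ioi z) ≤ a) :
    ν.real {p : ℝ | κ < p} ≤ a := by
  have := Measure.isProbabilityMeasure_map (μ := ν) (f := Neg.neg) measurable_neg.aemeasurable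
  have hlt := measureReal_coe_lt_le (ν := ν.map Neg.neg) (κ := -κ) ha fun z hz => by
    rw [map_measureReal_apply measurable_neg measurableSet_Iio]
    have := h (-z) (by rw [EReal.coe_neg]; exact EReal.lt_neg_comm.1 hz)
    simpa using this
  have hS : MeasurableSet {p : ℝ | (p : EReal) < -κ} := measurable_coe_real_ereal measurableSet_Iio
  rw [map_measureReal_apply measurable_neg hS] at hlt
  simpa [Set.preimage, EReal.neg_lt_neg_iff] using hlt

lemma measureReal_Iio_add_Ioi_le (ν : Measure ℝ) [IsProbabilityMeasure ν] (z : ℝ) :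
    ν.real (Set.Iio z) + ν.real (Set.Ioi z) ≤ 1 := by
  have hdisj : Disjoint (Set.Iio z) (Set.Ioi z) :=
    Set.disjoint_left.2 fun p (h : p < z) (h' : z < p) => lt_asymm h h'
  rw [← measureReal_union hdisj measurableSet_Ioi]
  exact measureReal_le_one

lemma one_sub_priceCDF (ν : Measure ℝ) [IsProbabilityMeasure ν] (κ : EReal) :
    1 - priceCDF ν κ = ν.real {p : ℝ | κ < p} := by
  have hS : MeasurableSet {p : ℝ | (p : EReal) ≤ κ} := measurable_coe_real_ereal measurableSet_Iic
  rw [priceCDF, ← probReal_compl_eq_one_sub hS]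
  congr 1
  ext p
  simp

lemma priceCDF_eq_measureReal_lt {ν : Measure ℝ} (hν : ν ≪ volume) (κ : EReal) :
    priceCDF ν κ = ν.real {p : ℝ | (p : EReal) < κ} := by
  have hnull : ν {p : ℝ | (p : EReal) = κ} = 0 :=
    hν (Set.Subsingleton.measure_zero (fun p hp q hq => by
      have : (p : EReal) = q := Eq.trans hp (Eq.symm hq)
      exact_mod_cast this) volume)
  rw [priceCDF, measureReal_def, measureReal_def]
  congr 1
  refine le_antisymm ?_ (measure_mono fun p (hp : (p : EReal) < κ) => hp.le)
  calc ν {p : ℝ | (p : EReal) ≤ κ}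
      ≤ ν ({p : ℝ | (p : EReal) < κ} ∪ {p : ℝ | (p : EReal) = κ}) :=
        measure_mono fun p (hp : (p : EReal) ≤ κ) => lt_or_eq_of_le hp
    _ ≤ ν {p : ℝ | (p : EReal) < κ} + ν {p : ℝ | (p : EReal) = κ} := measure_union_le _ _
    _ = ν {p : ℝ | (p : EReal) < κ} := by rw [hnull, add_zero]

section

variable {Ω : Type*} [MeasurableSpace Ω] {μ : Measure Ω}
  {P : BinPartition} {order : ℕ → Ω → LimitOrder} {time : ℕ → Ω → ℝ} {νb νa : Measure ℝ}
  [IsProbabilityMeasure νb] [IsProbabilityMeasure νa]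

lemma IsOrderFlow.one_sub_priceCDF_askThreshold (h : IsOrderFlow μ order time νb νa) :
    1 - priceCDF νa (askThreshold μ P order time) =
      priceCDF νb (bidThreshold μ P order time) := by
  have hle1 : ∀ (ν : Measure ℝ) [IsProbabilityMeasure ν] (S : Set ℝ), ν.real S ≤ 1 :=
    fun ν _ S => measureReal_le_one
  apply le_antisymm
  · rw [one_sub_priceCDF]
    refine measureReal_lt_coe_le measureReal_nonneg fun w hw => ?_
    have hlt : νb.real {p : ℝ | bidThreshold μ P order time < p} ≤ 1 - νa.real (Set.Ioi w) :=
      measureReal_lt_coe_le (by linarith [hle1 νa (Set.Ioi w)]) fun z hz => by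
        linarith [h.measure_Ioi_le_measure_Iio hz hw, measureReal_Iio_add_Ioi_le νb z]
    rw [← one_sub_priceCDF] at hlt
    linarith
  · rw [priceCDF_eq_measureReal_lt h.bid_ac]
    refine measureReal_coe_lt_le (by rw [one_sub_priceCDF]; exact measureReal_nonneg)
      fun z hz => ?_
    have hlt : νa.real {p : ℝ | (p : EReal) < askThreshold μ P order time} ≤
        1 - νb.real (Set.Iio z) :=
      measureReal_coe_lt_le (by linarith [hle1 νb (Set.Iio z)]) fun w hw => by
        linarith [h.measure_Iio_le_measure_Ioi hz hw, measureReal_Iio_add_Ioi_le νa w]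
    rw [← priceCDF_eq_measureReal_lt h.ask_ac] at hlt
    linarith

end

theorem mainTheorem4 {Ω : Type*} [MeasurableSpace Ω] (μ : Measure Ω) [IsProbabilityMeasure μ]
    (νb νa : Measure ℝ) [IsProbabilityMeasure νb] [IsProbabilityMeasure νa]
    (order : ℕ → Ω → LimitOrder) (time : ℕ → Ω → ℝ)
    (hflow : IsOrderFlow μ order time νb νa)
    (P : BinPartition) (x y : ℝ) (hxy : x < y)
    (hb : 0 < priceCDF νb x ∧ priceCDF νb x < priceCDF νb y ∧ priceCDF νb y < 1)
    (ha : 0 < priceCDF νa x ∧ priceCDF νa x < priceCDF νa y ∧ priceCDF νa y < 1)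
    (hP : P.Refines (BinPartition.three x y hxy))
    (h1 : priceCDF νb x = 1 - priceCDF νa y)
    (h2 : priceCDF νb y = 1 - priceCDF νa x)
    (X Y : ℝ) (hX : X = priceCDF νb x) (hY : Y = priceCDF νb y)
    (κb κa : EReal) (hκb : κb = bidThreshold μ P order time)
    (hκa : κa = askThreshold μ P order time) :
    1 - priceCDF νa κa = priceCDF νb κb ∧
    priceCDF νb κb ≥ (2 * X * (1 - X) - (1 - Y)) / ((1 - X) + (Y - X)) ∧
    (Y = 1 - X →
      0 < priceCDF νb κb ∧ priceCDF νa κa < 1 ∧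
      (κb ≠ ⊥ ∧ κb ≠ ⊤) ∧ (κa ≠ ⊥ ∧ κa ≠ ⊤)) := by
  have hbal : 1 - priceCDF νa κa = priceCDF νb κb := by
    rw [hκa, hκb]; exact hflow.one_sub_priceCDF_askThreshold
  rw [← hX, ← hY] at hb
  have hX0 : 0 < X := hb.1
  have hXY : X < Y := hb.2.1
  have hY1 : Y < 1 := hb.2.2
  have hbx : νb.real (Set.Iic x) = X := by rw [hX, priceCDF]; congr 1; ext p; simp
  have hby : νb.real (Set.Iic y) = Y := by rw [hY, priceCDF]; congr 1; ext p; simp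
  have hax : νa.real (Set.Iic x) = 1 - Y := by
    rw [hY, h2, sub_sub_cancel, priceCDF]; congr 1; ext p; simp
  have hay : νa.real (Set.Iic y) = 1 - X := by
    rw [hX, h1, sub_sub_cancel, priceCDF]; congr 1; ext p; simp
  -- the division of the prices at `x` and `y`
  let c : ℝ → SignType := fun p => if p ≤ x then .neg else if p ≤ y then .zero else .pos
  have hcneg : {p | c p = .neg} = Set.Iic x := by
    ext p; simp only [c, Set.mem_ofPred_eq, Set.mem_Iic]; split_ifs <;> simp_all
  have hczero : {p | c p = .zero} = Set.Iic y \ Set.Iic x := by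
    ext p; simp only [c, Set.mem_ofPred_eq, Set.mem_sdiff, Set.mem_Iic]; split_ifs <;> simp_all
  have hcpos : {p | c p = .pos} = (Set.Iic y)ᶜ := by
    ext p; simp only [c, Set.mem_ofPred_eq, Set.mem_compl_iff, Set.mem_Iic]
    split_ifs with h h' <;> simp_all
    linarith
  have hsub : Set.Iic x ⊆ Set.Iic y := Set.Iic_subset_Iic.2 hxy.le
  have hmono : Monotone c := fun p r hpr => by
    simp only [c]
    split_ifs <;> first | decide | (exfalso; linarith)
  have hcP : ∀ p r, P.SameBin p r → c p = c r := fun p r hpr => by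
    obtain ⟨D, hD, hp, hr⟩ := hP.sameBin hpr
    rcases hD with rfl | rfl | rfl
    · simp only [Set.mem_Iic] at hp hr
      simp [c, hp, hr]
    · simp [c, hp.1.not_ge, hp.2, hr.1.not_ge, hr.2]
    · simp only [Set.mem_Ioi] at hp hr
      simp [c, hp.not_ge, hr.not_ge, (hxy.trans hp).not_ge, (hxy.trans hr).not_ge]
  let q : SignType → ℝ
    | .neg => X
    | .zero => Y - X
    | .pos => 1 - Y
  have hqb : ∀ s, νb.real {p | c p = s} = q s := by
    rintro (_ | _ | _)
    · rw [hczero, measureReal_sdiff hsub measurableSet_Iic, hbx, hby]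
    · rw [hcneg, hbx]
    · rw [hcpos, probReal_compl_eq_one_sub measurableSet_Iic, hby]
  have hqa : ∀ s, νa.real {p | -c p = s} = q s := by
    have hneg : ∀ s, {p | -c p = s} = {p | c p = -s} := fun s => by
      ext p
      exact (by decide : ∀ s t : SignType, -t = s ↔ t = -s) s (c p)
    rintro (_ | _ | _) <;> rw [hneg]
    · rw [show -SignType.zero = .zero from rfl, hczero, measureReal_sdiff hsub measurableSet_Iic,
        hax, hay]
      change _ = Y - X
      ring
    · rw [show -SignType.neg = .pos from rfl, hcpos, probReal_compl_eq_one_sub measurableSet_Iic,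
        hay]
      change _ = X
      ring
    · rw [show -SignType.pos = .neg from rfl, hcneg, hax]
  have hD : 0 < (1 - X) + (Y - X) := by linarith
  -- `θ` is the balance weight required by the drift estimate
  set θ := (1 - Y) / ((1 - X) + (Y - X))
  have hθ : θ * ((1 - X) + (Y - X)) = 1 - Y := div_mul_cancel₀ _ hD.ne'
  have hθ0 : 0 ≤ θ := div_nonneg (by linarith) hD.le
  have hθ1 : θ ≤ 1 := (div_le_one hD).2 (by linarith)
  have hv : (2 * X * (1 - X) - (1 - Y)) / ((1 - X) + (Y - X)) =
      q .neg - θ * (q .zero + q .pos) := by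
    change _ = X - θ * ((Y - X) + (1 - Y))
    rw [div_eq_iff hD.ne']
    linear_combination (1 - X) * hθ
  have hlower : (2 * X * (1 - X) - (1 - Y)) / ((1 - X) + (Y - X)) ≤ priceCDF νb κb := by
    have hle : νb.real {p : ℝ | κb < p} ≤ 1 - (q .neg - θ * (q .zero + q .pos)) := by
      refine measureReal_lt_coe_le ?_ fun z hz => ?_
      · change 0 ≤ 1 - (X - θ * ((Y - X) + (1 - Y)))
        nlinarith
      · have hdrift := hflow.drift_le_measure_Iio hmono hcP hθ0 hθ1
          (q := q) (by change X + (Y - X) + (1 - Y) = 1; ring)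
          (by change θ * ((1 - Y) + 2 * (Y - X)) = 1 - Y; linarith) hqb hqa (hκb ▸ hz)
        linarith [measureReal_Iio_add_Ioi_le νb z]
    rw [← one_sub_priceCDF] at hle
    linarith
  refine ⟨hbal, hlower, fun hYX => ?_⟩
  have hpos : 0 < priceCDF νb κb := by
    refine lt_of_lt_of_le (div_pos ?_ hD) hlower
    nlinarith
  have hlt : priceCDF νb κb ≤ Y := by
    rw [priceCDF_eq_measureReal_lt hflow.bid_ac]
    refine measureReal_coe_lt_le (by linarith) fun z hz => ?_
    rw [← hby]
    refine hflow.measure_Iio_le_of_lt_bidThreshold hxy ?_ (hκb ▸ hz)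
    rw [hby, ← Set.compl_Iic, probReal_compl_eq_one_sub measurableSet_Iic, hax]
    ring
  have hbot : ∀ ν : Measure ℝ, priceCDF ν ⊥ = 0 := fun ν => by simp [priceCDF]
  have htop : ∀ (ν : Measure ℝ) [IsProbabilityMeasure ν], priceCDF ν ⊤ = 1 := fun ν _ => by
    simp [priceCDF]
  refine ⟨hpos, by linarith, ⟨?_, ?_⟩, ?_, ?_⟩ <;> rintro rfl
  · rw [hbot] at hpos; exact hpos.false
  · rw [htop] at hlt; linarith
  · rw [hbot] at hbal; linarith
  · rw [htop] at hbal; linarith
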